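/- Let $X=[0,1]$ with Borel $\sigma$-algebra $\mathcal B$ and Lebesgue measure $\lambda$. A *partition* of $[0,1]$ is a finite or countable collection $\mathcal A$ of intervals with nonempty, pairwise disjoint interiors whose union is $[0,1]$ up to a $\lambda$-null set. We write $(T,\mu,\mathcal A)\in\mathcal T$ if $\mu$ is a probability measure on $([0,1],\mathcal B)$, $T:[0,1]\to[0,1]$ is $\mathcal B$-measurable, $\mu$-preserving and $\mu$-ergodic, $\mathcal A$ is a partition, and: * there is $c\ge 1$ with $\frac1c\mu(A)\le\lambda(A)\le c\,\mu(A)$ for all $A\in\mathcal B$; * for every $I\in\mathcal A$, $T|_{\mathrm{int}(I)}$ is continuous and strictly monotone; * $\mathcal B=\bigvee_{j\ge0}T^{-j}\sigma(\mathcal A)$ modulo $\lambda$-null sets; * $-\sum_{I\in\mathcal A}\mu(I)\log\mu(I)<\infty$. Such a triple is *$\alpha$-mixing* if there are $\alpha(n)\ge0$ with $\alpha(n)\to0$ such that for all $l\ge1$, $n\ge0$, $A\in\sigma\big(\bigvee_{j=0}^{l-1}T^{-j}\mathcal A\big)$ and $B\in\mathcal B$, $$|\mu(A\cap T^{-(n+l)}B)-\mu(A)\mu(B)|\le\alpha(n).$$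 A $\mu$-preserving $T$ is *mixing* if $\mu(A\cap T^{-n}B)\to\mu(A)\mu(B)$ for all $A,B\in\mathcal B$, and *weakly mixing* if $T\times T$ is $\mu\times\mu$-ergodic. Let $h(T)$ denote the Kolmogorov–Sinai entropy of $T$ with respect to its invariant measure $\mu$. **Theorem.** Let $k\ge 0$ and let $(T_i,\mu_i,\mathcal A_i)\in\mathcal T$ for $i=0,1,\dots,k$. Suppose that $(T_i,\mu_i,\mathcal A_i)$ is $\alpha$-mixing for $i=1,\dots,k$, and that $0\le h(T_0)<h(T_1)<\dots<h(T_k)<\infty$. Let $\nu$ be any probability measure on $([0,1],\mathcal B)$ equivalent to $\lambda$. (i) If $T_0$ is mixing, then for all $B,A_0,\dots,A_k\in\mathcal B$, $$\lim_{n\to\infty}\nu\big(B\cap T_0^{-n}A_0\cap T_1^{-n}A_1\cap\dots\cap T_k^{-n}A_k\big)=\nu(B)\prod_{i=0}^k\mu_i(A_i).$$ (ii) If $T_0$ is weakly mixing, then for all $B,A_0,\dots,A_k\in\mathcal B$, $$\lim_{N-M\to\infty}\frac1{N-M}\sum_{n=M}^{N-1}\Big|\nu\big(B\cap T_0^{-n}A_0\cap\dots\cap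 T_k^{-n}A_k\big)-\nu(B)\prod_{i=0}^k\mu_i(A_i)\Big|=0,$$ where $M<N$ range over the nonnegative integers. -/

import Mathlib

open MeasureTheory Filter Topology Set
open scoped ENNReal unitInterval

noncomputable section

namespace JointErgodicity

/-! ### Kolmogorov–Sinai entropy -/

section Entropy

variable {X : Type*} [MeasurableSpace X]

/-- Shannon entropy `-∑ μ(P_a) log μ(P_a)` of the finite partition of `X` whose cells are the
fibres `P_a = f ⁻¹' {a}` of a labelling `f : X → ι`. -/
def partitionEntropy {ι : Type*} [Fintype ι] (μ : Measure X) (f : X → ι) : ℝ :=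
  ∑ a : ι, Real.negMulLog (μ.real (f ⁻¹' {a}))

/-- The labelling of the refined partition `⋁_{j < n} T^{-j} P`, where `P` is labelled by `f`. -/
def itinerary {ι : Type*} (T : X → X) (f : X → ι) (n : ℕ) : X → (Fin n → ι) :=
  fun x j => f (T^[(j : ℕ)] x)

/-- Entropy of `T` relative to the finite partition labelled by `f`:
`h(T, P) = lim_n (1/n) H(⋁_{j < n} T^{-j} P)`. (For a measure preserving `T` the limit exists,
so it equals the `limsup`.) -/
def entropyRel {ι : Type*} [Fintype ι] (μ : Measure X) (T : X → X) (f : X → ι) : ℝ≥0∞ :=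
  limsup (fun n : ℕ => ENNReal.ofReal (partitionEntropy μ (itinerary T f n) / (n : ℝ))) atTop

/-- Kolmogorov–Sinai entropy `h(T)` of `T` with respect to `μ`: the supremum of `h(T, P)` over all
finite measurable partitions `P`. -/
def ksEntropy (μ : Measure X) (T : X → X) : ℝ≥0∞ :=
  ⨆ (m : ℕ) (f : X → Fin m) (_ : Measurable f), entropyRel μ T f

end Entropy

/-! ### Mixing and weak mixing -/

section Mixing

variable {X : Type*} [MeasurableSpace X]

/-- `T` is (strongly) mixing with respect to `μ`. -/
def IsMixing (μ : Measure X) (T : X → X) : Prop :=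
  MeasurePreserving T μ μ ∧
    ∀ A B : Set X, MeasurableSet A → MeasurableSet B →
      Tendsto (fun n : ℕ => μ.real (A ∩ T^[n] ⁻¹' B)) atTop (𝓝 (μ.real A * μ.real B))

/-- `T` is weakly mixing with respect to `μ`: `T × T` is ergodic. -/
def IsWeaklyMixing (μ : Measure X) (T : X → X) : Prop :=
  MeasurePreserving T μ μ ∧ Ergodic (Prod.map T T) (μ.prod μ)

end Mixing

/-! ### Piecewise monotone maps of `[0, 1]` -/

/-- The interior, as a subset of the real line, of a subset of `[0, 1]`. -/
def realInterior (J : Set I) : Set I :=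
  Subtype.val ⁻¹' interior (Subtype.val '' J : Set ℝ)

/-- Partitions of `[0, 1]` into intervals: finite or countable collections of intervals with
nonempty, pairwise disjoint interiors, covering `[0, 1]` up to a Lebesgue null set. -/
structure IsIntervalPartition (𝒜 : Set (Set I)) : Prop where
  countable : 𝒜.Countable
  interval : ∀ J ∈ 𝒜, J.OrdConnected
  nonempty_interior : ∀ J ∈ 𝒜, (realInterior J).Nonempty
  disjoint_interior : 𝒜.PairwiseDisjoint realInterior
  cover : volume ((⋃₀ 𝒜)ᶜ) = 0

/-- `⋁_{j < l} T^{-j} σ(𝒜)`, the σ-algebra generated by the cylinders of rank `l`. -/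
abbrev cylinderAlgebra (T : I → I) (𝒜 : Set (Set I)) (l : ℕ) : MeasurableSpace I :=
  ⨆ j : Fin l, (MeasurableSpace.generateFrom 𝒜).comap (T^[(j : ℕ)])

/-- `⋁_{j ≥ 0} T^{-j} σ(𝒜)`. -/
abbrev fullCylinderAlgebra (T : I → I) (𝒜 : Set (Set I)) : MeasurableSpace I :=
  ⨆ j : ℕ, (MeasurableSpace.generateFrom 𝒜).comap (T^[j])

/-- The class `𝒯` of triples `(T, μ, 𝒜)`. -/
structure MemClassT (T : I → I) (μ : Measure I) (𝒜 : Set (Set I)) : Prop where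
  isProbabilityMeasure : IsProbabilityMeasure μ
  /-- `T` is measurable, preserves `μ`, and is ergodic. -/
  ergodic : Ergodic T μ
  comparable : ∃ c : ℝ, 1 ≤ c ∧ ∀ A : Set I, MeasurableSet A →
    c⁻¹ * μ.real A ≤ volume.real A ∧ volume.real A ≤ c * μ.real A
  partition : IsIntervalPartition 𝒜
  continuousOn : ∀ J ∈ 𝒜, ContinuousOn T (realInterior J)
  strictMonotone : ∀ J ∈ 𝒜, StrictMonoOn T (realInterior J) ∨ StrictAntiOn T (realInterior J)
  /-- `𝒜` generates the Borel σ-algebra modulo Lebesgue null sets. -/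
  generates : ∀ B : Set I, MeasurableSet B →
    ∃ B' : Set I, MeasurableSet[fullCylinderAlgebra T 𝒜] B' ∧ B =ᵐ[volume] B'
  /-- `H(𝒜) = -∑ μ(J) log μ(J) < ∞`; all the terms are nonnegative. -/
  finite_entropy : Summable (fun J : 𝒜 => Real.negMulLog (μ.real (J : Set I)))

/-- `α`-mixing of `(T, μ, 𝒜)`. -/
def IsAlphaMixing (T : I → I) (μ : Measure I) (𝒜 : Set (Set I)) : Prop :=
  ∃ α : ℕ → ℝ, (∀ n, 0 ≤ α n) ∧ Tendsto α atTop (𝓝 0) ∧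
    ∀ l : ℕ, 1 ≤ l → ∀ n : ℕ, ∀ A B : Set I,
      MeasurableSet[cylinderAlgebra T 𝒜 l] A → MeasurableSet B →
        |μ.real (A ∩ T^[n + l] ⁻¹' B) - μ.real A * μ.real B| ≤ α n

/-- The filter on pairs `(M, N)` of natural numbers describing `N - M → ∞`. -/
def gapAtTop : Filter (ℕ × ℕ) :=
  comap (fun p : ℕ × ℕ => (p.2 : ℤ) - (p.1 : ℤ)) atTop

end JointErgodicity

end

/-! The proof counts cylinders. By piecewise monotonicity a cylinder whose word avoids the label
`outside` is an interval (`MemClassT.ordConnected_cylinder`). If `h(T) < a`, about `exp (n a)`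
cylinders of rank `n` cover nearly all of `[0, 1]`, so `T^{-n} A` is close to a set with `O(exp (n
a))` endpoints (`MemClassT.lowComplexity_preimage`); this survives finite intersections. If `h(T) >
b`, then `exp (m b)` cylinders of rank `m` have small total measure for large `m`
(`eventually_measureReal_preimage_finset_le_of_generating`).

Let `a < b`, let `G n` have `O(exp (n a))` endpoints and let `T` be α-mixing with `h(T) > b`. Take
`n = j + m` with `j` fixed. The rank-`m` cylinders of `T` containing an endpoint are at most `exp (m
b)` in number, hence negligible; every other one lies inside or outside the approximating set. So `G
n` is almost a union of rank-`m` cylinders, and α-mixing across the gap `j` makes it independent of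
`T^{-n} A` up to about `α(j)` (`MemClassT.tendsto_of_isAlphaMixing`). Splitting off the maps from
the largest entropy downwards leaves `T_0` alone, and there mixing or weak mixing concludes. Since
each independence statement holds on every Borel set `B`, it passes from `μ_i` to `ν` through the
density.

The two counting facts are the halves of the Shannon–McMillan theorem, here for possibly countable
partitions, and both rest on the `L¹` mean ergodic theorem. The upper half assigns Markov weights to
words by means of a finite coarsening of nearly the same entropy. The lower half is proved for
finite partitions by martingale convergence, then carried to the generator by counting Hamming
balls. `MeanNull` treats both modes of convergence at once. -/

noncomputable section

namespace JointErgodicity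

/-! ### The mean ergodic theorem in `L¹` -/

section MeanErgodic

variable {X : Type*} [MeasurableSpace X] {μ : Measure X} {T : X → X}

theorem integrable_birkhoffSum (hT : MeasurePreserving T μ μ) {g : X → ℝ} (hg : Integrable g μ)
    (n : ℕ) : Integrable (birkhoffSum T g n) μ := by
  unfold birkhoffSum
  exact integrable_finsetSum _ fun j _ => (hT.iterate j).integrable_comp_of_integrable hg

theorem integrable_birkhoffAverage (hT : MeasurePreserving T μ μ) {g : X → ℝ}
    (hg : Integrable g μ) (n : ℕ) : Integrable (birkhoffAverage ℝ T g n) μ :=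
  (integrable_birkhoffSum hT hg n).smul ((n : ℝ)⁻¹)

theorem integral_comp_iterate (hT : MeasurePreserving T μ μ) {g : X → ℝ} (hg : Integrable g μ)
    (j : ℕ) : ∫ x, g (T^[j] x) ∂μ = ∫ x, g x ∂μ := by
  have h := hT.iterate j
  have := integral_map (μ := μ) h.measurable.aemeasurable (f := g)
    (by rw [h.map_eq]; exact hg.aestronglyMeasurable)
  rw [← this, h.map_eq]

theorem integral_birkhoffAverage (hT : MeasurePreserving T μ μ) {g : X → ℝ}
    (hg : Integrable g μ) {n : ℕ} (hn : n ≠ 0) :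
    ∫ x, birkhoffAverage ℝ T g n x ∂μ = ∫ x, g x ∂μ := by
  simp only [birkhoffAverage, birkhoffSum, smul_eq_mul]
  rw [integral_const_mul, integral_finsetSum (f := fun (j : ℕ) x => g (T^[j] x)) _
    fun j _ => (hT.iterate j).integrable_comp_of_integrable hg]
  simp only [integral_comp_iterate hT hg]
  have : (n : ℝ) ≠ 0 := by exact_mod_cast hn
  simp [this]

theorem integral_abs_birkhoffAverage_le (hT : MeasurePreserving T μ μ) {g : X → ℝ}
    (hg : Integrable g μ) (n : ℕ) :
    ∫ x, |birkhoffAverage ℝ T g n x| ∂μ ≤ ∫ x, |g x| ∂μ := by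
  rcases eq_or_ne n 0 with rfl | hn
  · simpa using integral_nonneg fun x => abs_nonneg (g x)
  rw [← integral_birkhoffAverage hT hg.abs hn]
  refine integral_mono (integrable_birkhoffAverage hT hg n).abs
    (integrable_birkhoffAverage hT hg.abs n) fun x => ?_
  simp only [birkhoffAverage, birkhoffSum, smul_eq_mul, abs_mul, abs_inv, Nat.abs_cast]
  gcongr
  exact Finset.abs_sum_le_sum_abs _ _

theorem integral_abs_le_norm_toLp [IsProbabilityMeasure μ] {g : X → ℝ} (hg : MemLp g 2 μ) :
    ∫ x, |g x| ∂μ ≤ ‖hg.toLp g‖ := by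
  have h1 : MemLp g 1 μ := hg.mono_exponent (by norm_num)
  have : ∫ x, |g x| ∂μ = (eLpNorm g 1 μ).toReal := by
    rw [eLpNorm_one_eq_lintegral_enorm, ← integral_norm_eq_lintegral_enorm hg.1]
    rfl
  rw [this, Lp.norm_toLp]
  exact ENNReal.toReal_mono hg.2.ne (eLpNorm_le_eLpNorm_of_exponent_le (by norm_num) hg.1)

/-- Von Neumann's theorem for the Koopman operator on `L²`: the averages converge to the projection
onto the invariant vectors, which ergodicity makes constant. On a probability space the `L²` norm
dominates the `L¹` norm. The constant is identified afterwards by integrating. -/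
theorem exists_tendsto_birkhoffAverage_of_memLp [IsProbabilityMeasure μ] (hT : Ergodic T μ)
    {g : X → ℝ} (hg : MemLp g 2 μ) :
    ∃ c : ℝ, Tendsto (fun n => ∫ x, |birkhoffAverage ℝ T g n x - c| ∂μ) atTop (𝓝 0) := by
  have hmp := hT.toMeasurePreserving
  let U : Lp ℝ 2 μ →L[ℝ] Lp ℝ 2 μ :=
    (Lp.compMeasurePreservingₗᵢ ℝ T hmp).toContinuousLinearMap
  have hU : ‖U‖ ≤ 1 := LinearIsometry.norm_toContinuousLinearMap_le _
  have key := U.tendsto_birkhoffAverage_orthogonalProjection hU (hg.toLp g)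
  set p := (U.eqLocus (1 : Lp ℝ 2 μ →L[ℝ] Lp ℝ 2 μ)).orthogonalProjectionOnto (hg.toLp g)
  have hp : U p.1 = p.1 := p.2
  have hpc : (p.1 : X → ℝ) ∘ T =ᵐ[μ] p.1 := by
    have := Lp.coeFn_compMeasurePreserving p.1 hmp
    refine this.symm.trans ?_
    have h2 : Lp.compMeasurePreserving T hmp p.1 = p.1 := hp
    rw [h2]
  obtain ⟨c, hc⟩ := hT.quasiErgodic.ae_eq_const_of_ae_eq_comp_ae
    (Lp.aestronglyMeasurable p.1) hpc
  have hiter : ∀ j : ℕ, (U^[j] (hg.toLp g) : X → ℝ) =ᵐ[μ] fun x => g (T^[j] x) := by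
    intro j
    induction j with
    | zero => simpa using hg.coeFn_toLp
    | succ j ih =>
      rw [Function.iterate_succ_apply']
      have h1 := Lp.coeFn_compMeasurePreserving (U^[j] (hg.toLp g)) hmp
      refine h1.trans ?_
      have h2 := hmp.quasiMeasurePreserving.ae_eq_comp ih
      refine h2.trans (Eventually.of_forall fun x => ?_)
      simp [Function.iterate_succ_apply]
  have hav : ∀ n : ℕ, (((birkhoffAverage ℝ U (fun u => u) n (hg.toLp g) : Lp ℝ 2 μ)) : X → ℝ) =ᵐ[μ]
      birkhoffAverage ℝ T g n := by
    intro n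
    change ((((n : ℝ)⁻¹ • ∑ j ∈ Finset.range n, U^[j] (hg.toLp g) : Lp ℝ 2 μ)) : X → ℝ) =ᵐ[μ] _
    refine (Lp.coeFn_smul _ _).trans ?_
    have h1 := Lp.coeFn_finsetSum (Finset.range n) fun j => U^[j] (hg.toLp g)
    have h2 : ∀ᵐ x ∂μ, ∀ j : ℕ, (U^[j] (hg.toLp g) : X → ℝ) x = g (T^[j] x) :=
      ae_all_iff.2 hiter
    filter_upwards [h1, h2] with x hx1 hx2
    rw [Pi.smul_apply, hx1, Finset.sum_apply]
    simp only [hx2]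
    rfl
  refine ⟨c, ?_⟩
  rw [tendsto_iff_norm_sub_tendsto_zero] at key
  refine squeeze_zero (fun n => integral_nonneg fun x => abs_nonneg _) (fun n => ?_) key
  have hm := Lp.memLp (birkhoffAverage ℝ U (fun u => u) n (hg.toLp g) - p.1)
  have h3 := integral_abs_le_norm_toLp hm
  rw [Lp.toLp_coeFn] at h3
  refine le_trans (le_of_eq ?_) h3
  refine integral_congr_ae ?_
  filter_upwards [hav n, hc, Lp.coeFn_sub (birkhoffAverage ℝ U (fun u => u) n (hg.toLp g)) p.1]
    with x h1 h2 h3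
  simp only [h3, Pi.sub_apply, h1, h2, Function.const_apply]

theorem eq_integral_of_tendsto_birkhoffAverage [IsProbabilityMeasure μ] (hT : MeasurePreserving T μ μ)
    {g : X → ℝ} (hg : Integrable g μ) {c : ℝ}
    (hc : Tendsto (fun n => ∫ x, |birkhoffAverage ℝ T g n x - c| ∂μ) atTop (𝓝 0)) :
    c = ∫ x, g x ∂μ := by
  have h : ∀ᶠ n : ℕ in atTop, |∫ x, g x ∂μ - c| ≤ ∫ x, |birkhoffAverage ℝ T g n x - c| ∂μ := by
    filter_upwards [eventually_ne_atTop 0] with n hn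
    rw [← integral_birkhoffAverage hT hg hn]
    have : ∫ x, birkhoffAverage ℝ T g n x ∂μ - c
        = ∫ x, (birkhoffAverage ℝ T g n x - c) ∂μ := by
      rw [integral_sub (integrable_birkhoffAverage hT hg n) (integrable_const c)]
      simp
    rw [this]
    exact abs_integral_le_integral_abs
  have h0 := ge_of_tendsto hc h
  have := abs_nonpos_iff.1 h0
  linarith

/-- **Mean ergodic theorem in `L¹`** for an ergodic transformation of a probability space. -/
theorem tendsto_integral_abs_birkhoffAverage_sub [IsProbabilityMeasure μ] (hT : Ergodic T μ)
    {g : X → ℝ} (hg : Integrable g μ) :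
    Tendsto (fun n => ∫ x, |birkhoffAverage ℝ T g n x - ∫ y, g y ∂μ| ∂μ) atTop (𝓝 0) := by
  have hmp := hT.toMeasurePreserving
  rw [Metric.tendsto_atTop]
  intro ε hε
  -- Simple functions lie in `L²`, and averaging contracts `L¹`, so replacing `g` by `s` costs at
  -- most `ε / 3` for every `n`.
  obtain ⟨s, hs, hsm⟩ := (memLp_one_iff_integrable.2 hg).exists_simpleFunc_eLpNorm_sub_lt
    (by norm_num) (ε := ENNReal.ofReal (ε / 3)) (by simpa using hε)
  have hs2 : MemLp s 2 μ := s.memLp_of_isFiniteMeasure 2 μ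
  have hsi : Integrable s μ := memLp_one_iff_integrable.1 hsm
  have hgs : ∫ x, |g x - s x| ∂μ < ε / 3 := by
    have : ∫ x, |g x - s x| ∂μ = (eLpNorm (g - ⇑s) 1 μ).toReal := by
      rw [eLpNorm_one_eq_lintegral_enorm,
        ← integral_norm_eq_lintegral_enorm (hg.sub hsi).aestronglyMeasurable]
      rfl
    rw [this]
    exact (ENNReal.toReal_lt_of_lt_ofReal hs)
  obtain ⟨c, hc⟩ := exists_tendsto_birkhoffAverage_of_memLp hT hs2
  rw [eq_integral_of_tendsto_birkhoffAverage hmp hsi hc] at hc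
  obtain ⟨N, hN⟩ := (Metric.tendsto_atTop.1 hc) (ε / 3) (by positivity)
  refine ⟨N, fun n hn => ?_⟩
  have h1 := hN n hn
  rw [Real.dist_0_eq_abs, abs_of_nonneg (integral_nonneg fun x => abs_nonneg _)] at h1 ⊢
  have h2 : |∫ y, s y ∂μ - ∫ y, g y ∂μ| ≤ ∫ x, |g x - s x| ∂μ := by
    rw [abs_sub_comm, ← integral_sub hg hsi]
    exact abs_integral_le_integral_abs
  have h3 := integral_abs_birkhoffAverage_le hmp (hg.sub hsi) n
  have hi := fun (u : X → ℝ) (hu : Integrable u μ) => integrable_birkhoffAverage hmp hu n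
  have hu : Integrable (fun x => |birkhoffAverage ℝ T (g - ⇑s) n x|) μ := (hi _ (hg.sub hsi)).abs
  have hv : Integrable (fun x => |birkhoffAverage ℝ T s n x - ∫ y, s y ∂μ|) μ :=
    ((hi s hsi).sub (integrable_const _)).abs
  have huv : Integrable (fun x => |birkhoffAverage ℝ T (g - ⇑s) n x|
      + |birkhoffAverage ℝ T s n x - ∫ y, s y ∂μ|) μ := hu.add hv
  calc ∫ x, |birkhoffAverage ℝ T g n x - ∫ y, g y ∂μ| ∂μ
      ≤ ∫ x, (|birkhoffAverage ℝ T (g - ⇑s) n x| + |birkhoffAverage ℝ T s n x - ∫ y, s y ∂μ|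
          + |∫ y, s y ∂μ - ∫ y, g y ∂μ|) ∂μ := by
        refine integral_mono ((hi g hg).sub (integrable_const _)).abs
          (huv.add (integrable_const _)) fun x => ?_
        have hx : birkhoffAverage ℝ T (g - ⇑s) n x
            = birkhoffAverage ℝ T g n x - birkhoffAverage ℝ T s n x := by
          rw [birkhoffAverage_sub]; rfl
        simp only [hx]
        refine le_trans (le_of_eq ?_) (abs_add_three _ _ _)
        congr 1
        ring
    _ = ∫ x, |birkhoffAverage ℝ T (g - ⇑s) n x| ∂μ
          + ∫ x, |birkhoffAverage ℝ T s n x - ∫ y, s y ∂μ| ∂μ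
          + |∫ y, s y ∂μ - ∫ y, g y ∂μ| := by
        rw [integral_add huv (integrable_const _), integral_add hu hv]
        simp
    _ < ε := by
        have : ∫ x, |(g - ⇑s) x| ∂μ = ∫ x, |g x - s x| ∂μ := rfl
        linarith

/-- Markov's inequality for the absolute value of a real function. -/
theorem mul_measureReal_ge_abs_le_integral_abs [IsFiniteMeasure μ] {g : X → ℝ} (hg : Integrable g μ)
    (ε : ℝ) : ε * μ.real {x | ε ≤ |g x|} ≤ ∫ x, |g x| ∂μ :=
  mul_meas_ge_le_integral_of_nonneg (Eventually.of_forall fun x => abs_nonneg (g x)) hg.abs ε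

end MeanErgodic

/-! ### Countable partitions and itineraries -/

section Itinerary

variable {X : Type*} {T : X → X} {ι : Type*} {f : X → ι}

theorem itinerary_tail (n : ℕ) (x : X) :
    Fin.tail (itinerary T f (n + 1) x) = itinerary T f n (T x) := by
  funext j
  simp [Fin.tail, itinerary]

theorem itinerary_succ (n : ℕ) (x : X) :
    itinerary T f (n + 1) x = Fin.cons (f x) (itinerary T f n (T x)) := by
  rw [← itinerary_tail, ← Fin.cons_self_tail (itinerary T f (n + 1) x)]
  rfl

theorem tsum_cons {n : ℕ} (F : (Fin (n + 1) → ι) → ℝ≥0∞) :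
    ∑' w, F w = ∑' (v : Fin n → ι) (a : ι), F (Fin.cons a v) := by
  rw [← (Fin.consEquiv fun _ : Fin (n + 1) => ι).tsum_eq F, ENNReal.tsum_prod', ENNReal.tsum_comm]
  rfl

variable [MeasurableSpace X] {μ : Measure X} [MeasurableSpace ι]

theorem measurable_itinerary (hT : Measurable T) (hf : Measurable f) (n : ℕ) :
    Measurable (itinerary T f n) :=
  measurable_pi_lambda _ fun j => hf.comp (hT.iterate j)

variable [DiscreteMeasurableSpace ι]

theorem measurableSet_preimage_discrete (hf : Measurable f) (S : Set ι) :
    MeasurableSet (f ⁻¹' S) := hf (MeasurableSet.of_discrete)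

variable [Countable ι]

/-- There are countably many labels, so the union of the null fibres is null. This justifies the
logarithm rules almost everywhere. -/
theorem ae_measure_fiber_ne_zero (hf : Measurable f) :
    ∀ᵐ x ∂μ, μ (f ⁻¹' {f x}) ≠ 0 := by
  have h : ∀ᵐ a ∂(μ.map f), (μ.map f) {a} ≠ 0 := by
    rw [ae_iff_of_countable]
    exact fun a ha => ha
  have h2 := ae_of_ae_map hf.aemeasurable h
  filter_upwards [h2] with x hx
  rwa [Measure.map_apply hf (measurableSet_singleton _)] at hx

theorem ae_measureReal_fiber_pos [IsFiniteMeasure μ] (hf : Measurable f) :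
    ∀ᵐ x ∂μ, 0 < μ.real (f ⁻¹' {f x}) := by
  filter_upwards [ae_measure_fiber_ne_zero (μ := μ) hf] with x hx
  exact ENNReal.toReal_pos hx (measure_ne_top _ _)

theorem lintegral_comp_countable (hf : Measurable f) (F : ι → ℝ≥0∞) :
    ∫⁻ x, F (f x) ∂μ = ∑' a, F a * μ (f ⁻¹' {a}) := by
  rw [← lintegral_map (f := F) (measurable_of_countable F) hf, lintegral_countable']
  exact tsum_congr fun a => by rw [Measure.map_apply hf (measurableSet_singleton _)]

theorem integrable_comp_countable [IsFiniteMeasure μ] (hf : Measurable f) {F : ι → ℝ}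
    (hF : Summable fun a => μ.real (f ⁻¹' {a}) * |F a|) : Integrable (fun x => F (f x)) μ := by
  refine ⟨((measurable_of_countable F).comp hf).aestronglyMeasurable, ?_⟩
  rw [hasFiniteIntegral_iff_enorm, lintegral_comp_countable hf fun a => ‖F a‖ₑ]
  have : ∀ a, ‖F a‖ₑ * μ (f ⁻¹' {a}) = ENNReal.ofReal (μ.real (f ⁻¹' {a}) * |F a|) := by
    intro a
    rw [ENNReal.ofReal_mul measureReal_nonneg, ofReal_measureReal, mul_comm,
      ← Real.enorm_eq_ofReal_abs]
  simp only [this]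
  exact hF.tsum_ofReal_lt_top

theorem integral_comp_countable [IsFiniteMeasure μ] (hf : Measurable f) {F : ι → ℝ}
    (hF : Integrable (fun x => F (f x)) μ) :
    ∫ x, F (f x) ∂μ = ∑' a, μ.real (f ⁻¹' {a}) * F a := by
  have hm : AEStronglyMeasurable F (μ.map f) :=
    (measurable_of_countable F).aestronglyMeasurable
  rw [← integral_map (f := F) hf.aemeasurable hm, integral_countable]
  · refine tsum_congr fun a => ?_
    rw [map_measureReal_apply hf (measurableSet_singleton _), smul_eq_mul]
  · exact (integrable_map_measure hm hf.aemeasurable).2 hF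

theorem integrable_neg_log_fiber [IsProbabilityMeasure μ] (hf : Measurable f)
    (h : Summable fun a => Real.negMulLog (μ.real (f ⁻¹' {a}))) :
    Integrable (fun x => -Real.log (μ.real (f ⁻¹' {f x}))) μ := by
  refine integrable_comp_countable (F := fun a => -Real.log (μ.real (f ⁻¹' {a}))) hf ?_
  refine h.congr fun a => ?_
  rw [abs_of_nonneg (by
    have := Real.log_nonpos measureReal_nonneg (measureReal_le_one (μ := μ) (s := f ⁻¹' {a}))
    linarith), Real.negMulLog]
  ring

theorem integral_neg_log_fiber [IsProbabilityMeasure μ] (hf : Measurable f)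
    (h : Summable fun a => Real.negMulLog (μ.real (f ⁻¹' {a}))) :
    ∫ x, -Real.log (μ.real (f ⁻¹' {f x})) ∂μ = ∑' a, Real.negMulLog (μ.real (f ⁻¹' {a})) := by
  rw [integral_comp_countable (F := fun a => -Real.log (μ.real (f ⁻¹' {a}))) hf
    (integrable_neg_log_fiber hf h)]
  exact tsum_congr fun a => by rw [Real.negMulLog]; ring

theorem integral_neg_log_fiber_fintype [IsProbabilityMeasure μ] [Fintype ι] (hf : Measurable f) :
    ∫ x, -Real.log (μ.real (f ⁻¹' {f x})) ∂μ = partitionEntropy μ f := by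
  rw [integral_neg_log_fiber hf Summable.of_finite, tsum_fintype]
  rfl

theorem exists_measureReal_lt_of_measurable [IsFiniteMeasure μ] {g : X → ℝ} (hg : Measurable g)
    {δ : ℝ} (hδ : 0 < δ) : ∃ R : ℝ, μ.real {x | R < g x} < δ := by
  have h := tendsto_measure_iInter_atTop (μ := μ) (s := fun n : ℕ => {x | (n : ℝ) < g x})
    (fun n => (measurableSet_lt measurable_const hg).nullMeasurableSet)
    (fun m n hmn x (hx : (n : ℝ) < g x) => lt_of_le_of_lt (by exact_mod_cast hmn) hx)
    ⟨0, measure_ne_top _ _⟩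
  have he : ⋂ n : ℕ, {x | (n : ℝ) < g x} = ∅ := by
    ext x
    simp only [mem_iInter, mem_ofPred_eq, mem_empty_iff_false, iff_false, not_forall, not_lt]
    exact exists_nat_ge (g x)
  rw [he, measure_empty] at h
  have h2 := (ENNReal.tendsto_toReal ENNReal.zero_ne_top).comp h
  obtain ⟨n, hn⟩ := (h2.eventually_lt_const (u := δ) (by simpa using hδ)).exists
  exact ⟨n, hn⟩

end Itinerary

/-! ### Covering most of the space by few cylinders -/

section MarkovWeight

variable {X : Type*} {T : X → X} {ι : Type*} {f : X → ι}

/-- The weight on words of length `k + n` obtained from the weight `ρ` of their last `k` letters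
and the transition weights `φ`, read from right to left. -/
def markovWeight {k : ℕ} (ρ : (Fin k → ι) → ℝ≥0∞) (φ : (Fin (k + 1) → ι) → ℝ≥0∞) :
    (n : ℕ) → (Fin (k + n) → ι) → ℝ≥0∞
  | 0 => ρ
  | n + 1 => fun w => φ (fun i => w (Fin.castLE (by omega) i)) *
      markovWeight ρ φ n (Fin.tail (n := k + n) w)

/-- Prepending a letter multiplies the weight by a transition weight whose sum over that letter is
at most one, so the first letter can be summed out. -/
theorem tsum_markovWeight_le {k : ℕ} {ρ : (Fin k → ι) → ℝ≥0∞} {φ : (Fin (k + 1) → ι) → ℝ≥0∞}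
    (hρ : ∑' w, ρ w ≤ 1) (hφ : ∀ v, ∑' a, φ (Fin.cons a v) ≤ 1) (n : ℕ) :
    ∑' w, markovWeight ρ φ n w ≤ 1 := by
  induction n with
  | zero => exact hρ
  | succ n ih =>
    refine le_trans ?_ ih
    change ∑' w : Fin (k + n + 1) → ι, markovWeight ρ φ (n + 1) w ≤ _
    rw [tsum_cons]
    refine ENNReal.tsum_le_tsum fun v => ?_
    have h : ∀ a : ι, markovWeight ρ φ (n + 1) (Fin.cons (n := k + n) a v)
        = φ (Fin.cons a fun i : Fin k => v (Fin.castLE (by omega) i)) * markovWeight ρ φ n v := by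
      intro a
      simp only [markovWeight]
      congr 2
      funext i
      refine Fin.cases ?_ (fun i => ?_) i
      · rfl
      · rfl
    rw [tsum_congr h, ENNReal.tsum_mul_right]
    exact mul_le_of_le_one_left (zero_le) (hφ _)

theorem neg_log_markovWeight {k : ℕ} {ρ : (Fin k → ι) → ℝ≥0∞} {φ : (Fin (k + 1) → ι) → ℝ≥0∞}
    (n : ℕ) : ∀ x : X,
    (∀ j, 0 < (φ (itinerary T f (k + 1) (T^[j] x))).toReal) →
    (0 < (ρ (itinerary T f k (T^[n] x))).toReal) →
    0 < (markovWeight ρ φ n (itinerary T f (k + n) x)).toReal ∧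
    -Real.log (markovWeight ρ φ n (itinerary T f (k + n) x)).toReal =
      -Real.log (ρ (itinerary T f k (T^[n] x))).toReal +
      ∑ j ∈ Finset.range n, -Real.log (φ (itinerary T f (k + 1) (T^[j] x))).toReal := by
  induction n with
  | zero => intro x _ h; simpa [markovWeight] using h
  | succ n ih =>
    intro x hx hρ
    obtain ⟨h1, h2⟩ := ih (T x) (fun j => by simpa using hx (j + 1)) (by simpa using hρ)
    have e : markovWeight ρ φ (n + 1) (itinerary T f (k + (n + 1)) x)
        = φ (itinerary T f (k + 1) x) * markovWeight ρ φ n (itinerary T f (k + n) (T x)) := by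
      simp only [markovWeight]
      rw [← itinerary_tail]
      rfl
    have h0 := hx 0
    simp only [Function.iterate_zero, _root_.id] at h0
    rw [e, ENNReal.toReal_mul, Real.log_mul h0.ne' h1.ne', neg_add, h2, Finset.sum_range_succ']
    refine ⟨mul_pos h0 h1, ?_⟩
    simp only [Function.iterate_succ_apply, Function.iterate_zero, _root_.id]
    ring

variable [MeasurableSpace X] {μ : Measure X} [Countable ι] [MeasurableSpace ι]
  [DiscreteMeasurableSpace ι]

/-- Since the weights sum to at most one, at most `exp (n a)` words have weight at least `exp (-n
a)`. By the mean ergodic theorem the itinerary of a typical point is such a word: its negative log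
weight is about `n` times the mean of `-log φ`, which is below `a`. -/
theorem eventually_exists_finset_of_markovWeight [IsProbabilityMeasure μ] (hT : Ergodic T μ)
    (hf : Measurable f) {k : ℕ} {φ : (Fin (k + 1) → ι) → ℝ≥0∞}
    (hφ : ∀ v, ∑' a, φ (Fin.cons a v) ≤ 1)
    (hpos : ∀ᵐ x ∂μ, 0 < (φ (itinerary T f (k + 1) x)).toReal)
    (hint : Integrable (fun x => -Real.log (φ (itinerary T f (k + 1) x)).toReal) μ) {a : ℝ}
    (ha : 0 ≤ a) (hlt : ∫ x, -Real.log (φ (itinerary T f (k + 1) x)).toReal ∂μ < a)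
    {δ : ℝ} (hδ : 0 < δ) :
    ∀ᶠ N : ℕ in atTop, ∃ S : Finset (Fin N → ι), (S.card : ℝ) ≤ Real.exp (N * a) ∧
      μ.real (itinerary T f N ⁻¹' (S : Set (Fin N → ι)))ᶜ ≤ δ := by
  have hmp := hT.toMeasurePreserving
  have hTm := hmp.measurable
  set G : X → ℝ := fun x => -Real.log (φ (itinerary T f (k + 1) x)).toReal with hG
  -- Half of the gap pays for the fluctuation of the Birkhoff average, the other half for the weight
  -- of the last `k` letters.
  set c := (a - ∫ x, G x ∂μ) / 2 with hc
  have hc0 : 0 < c := by simp only [hc]; linarith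
  let ρ : (Fin k → ι) → ℝ≥0∞ := fun w => μ (itinerary T f k ⁻¹' {w})
  have hρ : ∑' w, ρ w ≤ 1 := by
    have := lintegral_comp_countable (μ := μ) (measurable_itinerary hTm hf k) fun _ => 1
    simp only [lintegral_one, measure_univ, one_mul] at this
    exact this.symm.le
  have hρpos : ∀ᵐ x ∂μ, 0 < (ρ (itinerary T f k x)).toReal :=
    ae_measureReal_fiber_pos (measurable_itinerary hTm hf k)
  -- Off a set of measure less than `δ / 2` the last `k` letters cost at most `R`, and `R ≤ n * c`
  -- for large `n`.
  obtain ⟨R, hR⟩ := exists_measureReal_lt_of_measurable (μ := μ)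
    (g := fun x => -Real.log (ρ (itinerary T f k x)).toReal)
    ((measurable_of_countable fun w => -Real.log (ρ w).toReal).comp (measurable_itinerary hTm hf k))
    (half_pos hδ)
  have herg := tendsto_integral_abs_birkhoffAverage_sub hT hint
  have hev : ∀ᶠ n : ℕ in atTop, ∃ S : Finset (Fin (k + n) → ι),
      (S.card : ℝ) ≤ Real.exp (n * a) ∧
      μ.real (itinerary T f (k + n) ⁻¹' (S : Set (Fin (k + n) → ι)))ᶜ ≤ δ := by
    filter_upwards [herg.eventually_lt_const (u := c * (δ / 2)) (by positivity),
      (tendsto_natCast_atTop_atTop (R := ℝ)).eventually_ge_atTop (R / c),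
      eventually_gt_atTop 0] with n hn hnR hn0
    have hn0' : (0 : ℝ) < n := by exact_mod_cast hn0
    have hne : ENNReal.ofReal (Real.exp (-(n * a))) ≠ 0 := by
      simpa using Real.exp_pos _
    obtain ⟨hfin, hcard⟩ := ENNReal.finset_card_const_le_le_of_tsum_le ENNReal.one_ne_top
      (tsum_markovWeight_le hρ hφ n) hne
    refine ⟨hfin.toFinset, ?_, ?_⟩
    · have h1 : (1 : ℝ≥0∞) / ENNReal.ofReal (Real.exp (-(n * a)))
          = ENNReal.ofReal (Real.exp (n * a)) := by
        rw [Real.exp_neg, ENNReal.ofReal_inv_of_pos (Real.exp_pos _), one_div, inv_inv]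
      rw [h1] at hcard
      have := ENNReal.toReal_mono ENNReal.ofReal_ne_top hcard
      rwa [ENNReal.toReal_ofReal (Real.exp_pos _).le, ENNReal.toReal_natCast] at this
    · set B1 := {x | c ≤ |birkhoffAverage ℝ T G n x - ∫ y, G y ∂μ|}
      set B2 := T^[n] ⁻¹' {x | R < -Real.log (ρ (itinerary T f k x)).toReal}
      have hB1 : μ.real B1 ≤ δ / 2 := by
        have := mul_measureReal_ge_abs_le_integral_abs
          ((integrable_birkhoffAverage hmp hint n).sub (integrable_const (∫ y, G y ∂μ))) c
        have h3 : c * μ.real B1 < c * (δ / 2) := lt_of_le_of_lt this hn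
        exact (lt_of_mul_lt_mul_left h3 hc0.le).le
      have hB2 : μ.real B2 ≤ δ / 2 := by
        rw [(hmp.iterate n).measureReal_preimage]
        · exact hR.le
        · exact (measurableSet_lt measurable_const ((measurable_of_countable fun w =>
            -Real.log (ρ w).toReal).comp (measurable_itinerary hTm hf k))).nullMeasurableSet
      have hsub : ((itinerary T f (k + n) ⁻¹' (hfin.toFinset : Set (Fin (k + n) → ι)))ᶜ : Set X)
          ≤ᵐ[μ] (B1 ∪ B2 : Set X) := by
        have hall : ∀ᵐ x ∂μ, ∀ j, 0 < (φ (itinerary T f (k + 1) (T^[j] x))).toReal :=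
          ae_all_iff.2 fun j => (hmp.iterate j).quasiMeasurePreserving.ae hpos
        have hρn := (hmp.iterate n).quasiMeasurePreserving.ae hρpos
        filter_upwards [hall, hρn] with x hx1 hx2 hx
        by_contra hcon
        have hcon' : x ∉ B1 ∧ x ∉ B2 := by
          constructor
          · exact fun h => hcon (Or.inl h)
          · exact fun h => hcon (Or.inr h)
        obtain ⟨hnot1, hnot2⟩ := hcon'
        have h1 : |birkhoffAverage ℝ T G n x - ∫ y, G y ∂μ| < c := not_le.1 hnot1
        have h2 : -Real.log (ρ (itinerary T f k (T^[n] x))).toReal ≤ R := not_lt.1 hnot2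
        obtain ⟨hw, hlog⟩ := neg_log_markovWeight n x hx1 hx2
        have hsum : ∑ j ∈ Finset.range n, -Real.log (φ (itinerary T f (k + 1) (T^[j] x))).toReal
            = n * birkhoffAverage ℝ T G n x := by
          simp only [birkhoffAverage, birkhoffSum, smul_eq_mul, hG]
          field_simp
        apply hx
        simp only [Finite.coe_toFinset, mem_preimage, mem_ofPred_eq]
        rw [← ENNReal.ofReal_toReal (a := markovWeight ρ φ n (itinerary T f (k + n) x))
          (fun h => by simp [h] at hw)]
        refine ENNReal.ofReal_le_ofReal ?_
        rw [← Real.exp_log hw]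
        refine Real.exp_le_exp.2 ?_
        have h4 : (n : ℝ) * birkhoffAverage ℝ T G n x ≤ n * (∫ y, G y ∂μ + c) :=
          mul_le_mul_of_nonneg_left (by linarith [(abs_lt.1 h1).2]) hn0'.le
        have h5 : R ≤ n * c := by rwa [div_le_iff₀ hc0] at hnR
        have h6 : (n : ℝ) * a = n * (∫ y, G y ∂μ + c) + n * c := by simp only [hc]; ring
        rw [hsum] at hlog
        linarith
      have h7 : μ.real (itinerary T f (k + n) ⁻¹' (hfin.toFinset : Set (Fin (k + n) → ι)))ᶜ
          ≤ μ.real (B1 ∪ B2) :=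
        ENNReal.toReal_mono (measure_ne_top _ _) (measure_mono_ae hsub)
      linarith [measureReal_union_le (μ := μ) B1 B2]
  obtain ⟨n0, hn0⟩ := eventually_atTop.1 hev
  refine eventually_atTop.2 ⟨k + n0, fun N hN => ?_⟩
  obtain ⟨n, rfl⟩ : ∃ n, N = k + n := ⟨N - k, by omega⟩
  obtain ⟨S, hS, hS2⟩ := hn0 n (by omega)
  refine ⟨S, hS.trans (Real.exp_le_exp.2 ?_), hS2⟩
  push_cast
  nlinarith [Nat.cast_nonneg (α := ℝ) k]

end MarkovWeight

/-! ### Transition weights from a finite coarsening, and the upper entropy bound. -/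

section EntropyCover

variable {X : Type*} [MeasurableSpace X] {μ : Measure X} {T : X → X}

theorem partitionEntropy_nonneg [IsProbabilityMeasure μ] {ι : Type*} [Fintype ι] (f : X → ι) :
    0 ≤ partitionEntropy μ f :=
  Finset.sum_nonneg fun _ _ => Real.negMulLog_nonneg measureReal_nonneg measureReal_le_one

/-- The increments telescope: if all were at least `a`, the entropy of the `n`-th join would be at
least `n a`, and the limsup at least `a`. -/
theorem exists_entropy_increment_lt [IsProbabilityMeasure μ] {ι : Type*} [Fintype ι] {f : X → ι}
    {a : ℝ} (h : entropyRel μ T f < ENNReal.ofReal a) :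
    ∃ k : ℕ, partitionEntropy μ (itinerary T f (k + 1)) - partitionEntropy μ (itinerary T f k)
      < a := by
  by_contra! hcon
  have hlin : ∀ n : ℕ, n * a ≤ partitionEntropy μ (itinerary T f n) := by
    intro n
    induction n with
    | zero => simpa using partitionEntropy_nonneg _
    | succ n ih => push_cast; linarith [hcon n]
  refine absurd h (not_lt.2 ?_)
  refine le_limsup_of_frequently_le (Eventually.frequently ?_)
  filter_upwards [eventually_gt_atTop 0] with n hn
  have hn' : (0 : ℝ) < n := by exact_mod_cast hn
  exact ENNReal.ofReal_le_ofReal ((le_div_iff₀ hn').2 (by rw [mul_comm]; exact hlin n))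

theorem entropyRel_le_ksEntropy {m : ℕ} {f : X → Fin m} (hf : Measurable f) :
    entropyRel μ T f ≤ ksEntropy μ T :=
  le_iSup_of_le m (le_iSup_of_le f (le_iSup_of_le hf le_rfl))

/-- A partition of finite entropy has finite coarsenings of almost the same entropy. -/
theorem exists_finite_coarsening [IsProbabilityMeasure μ] {ι : Type*} {f : X → ι}
    (hsum : Summable fun a => Real.negMulLog (μ.real (f ⁻¹' {a}))) {ε : ℝ} (hε : 0 < ε) :
    ∃ (m : ℕ) (π : ι → Fin m),
      ∑' a, Real.negMulLog (μ.real (f ⁻¹' {a})) < partitionEntropy μ (π ∘ f) + ε := by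
  classical
  have h := (hsum.hasSum.eventually_const_lt
    (show ∑' a, Real.negMulLog (μ.real (f ⁻¹' {a})) - ε < _ by linarith)).exists
  obtain ⟨s, hs⟩ := h
  -- The letters of `s` stay distinct, and all others are merged into one extra label, whose entropy
  -- term is nonnegative.
  refine ⟨s.card + 1, fun a => if h : a ∈ s then (s.equivFin ⟨a, h⟩).castSucc else Fin.last _, ?_⟩
  set π : ι → Fin (s.card + 1) :=
    fun a => if h : a ∈ s then (s.equivFin ⟨a, h⟩).castSucc else Fin.last _ with hπ
  have hpre : ∀ a : s, (π ∘ f) ⁻¹' {(s.equivFin a).castSucc} = f ⁻¹' {(a : ι)} := by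
    intro a
    ext x
    simp only [mem_preimage, Function.comp, mem_singleton_iff, hπ]
    constructor
    · intro hx
      split_ifs at hx with h
      · have := s.equivFin.injective (Fin.castSucc_injective _ hx)
        exact congrArg Subtype.val this
      · exact absurd hx.symm (Fin.castSucc_lt_last _).ne
    · rintro hx
      have h : f x ∈ s := hx ▸ a.2
      rw [dif_pos h]
      congr 2
      exact Subtype.ext hx
  have hle : ∑ a ∈ s, Real.negMulLog (μ.real (f ⁻¹' {a})) ≤ partitionEntropy μ (π ∘ f) := by
    unfold partitionEntropy
    rw [Fin.sum_univ_castSucc, ← s.sum_coe_sort, ← s.equivFin.sum_comp]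
    refine le_trans (le_of_eq ?_) (le_add_of_nonneg_right
      (Real.negMulLog_nonneg measureReal_nonneg measureReal_le_one))
    exact Finset.sum_congr rfl fun a _ => by rw [hpre]
  linarith

variable {ι : Type*} [Countable ι] [MeasurableSpace ι] [DiscreteMeasurableSpace ι] {f : X → ι}

/-- The conditional probability of the first letter of a word given the next `k` letters, seen
through a coarsening `π`, times the conditional probability of the letter given its image. -/
def transitionWeight (μ : Measure X) (T : X → X) (f : X → ι) {m : ℕ} (π : ι → Fin m) (k : ℕ)
    (w : Fin (k + 1) → ι) : ℝ≥0∞ :=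
  μ (itinerary T (π ∘ f) (k + 1) ⁻¹' {π ∘ w}) / μ (itinerary T (π ∘ f) k ⁻¹' {π ∘ Fin.tail w}) *
    (μ (f ⁻¹' {w 0}) / μ ((π ∘ f) ⁻¹' {π (w 0)}))

/-- Summing over the letters of one class of `π` makes the second factor at most one. The cylinders
left over are disjoint and lie in the `T`-preimage of the cylinder in the denominator, which has the
same measure by invariance. Null cylinders give `0 / 0 = 0`, hence only an inequality. -/
theorem tsum_transitionWeight_le (hT : MeasurePreserving T μ μ) (hf : Measurable f) {m : ℕ}
    (π : ι → Fin m) (k : ℕ) (v : Fin k → ι) :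
    ∑' a, transitionWeight μ T f π k (Fin.cons a v) ≤ 1 := by
  have hP : Measurable (π ∘ f) := (measurable_of_countable π).comp hf
  set A : Fin m → Set X := fun b => itinerary T (π ∘ f) (k + 1) ⁻¹' {Fin.cons b (π ∘ v)}
  set D := μ (itinerary T (π ∘ f) k ⁻¹' {π ∘ v})
  let F : Fin m → ℝ≥0∞ := fun b => μ (A b) / D / μ ((π ∘ f) ⁻¹' {b})
  have hcons : ∀ a, π ∘ (Fin.cons a v : Fin (k + 1) → ι)
      = (Fin.cons (π a) (π ∘ v) : Fin (k + 1) → Fin m) := by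
    intro a
    funext i
    refine Fin.cases ?_ (fun i => ?_) i <;> rfl
  have h1 : ∀ a, transitionWeight μ T f π k (Fin.cons a v) = (F ∘ π) a * μ (f ⁻¹' {a}) := by
    intro a
    simp only [transitionWeight, hcons, Fin.tail_cons, Fin.cons_zero, F, A, D, Function.comp]
    simp only [div_eq_mul_inv]
    ring
  have h2 : ∑' b, μ (A b) ≤ D := by
    have hdisj : Pairwise (Function.onFun Disjoint A) := by
      intro b c hbc
      refine Disjoint.preimage _ (disjoint_singleton.2 fun h => hbc ?_)
      simpa using congrFun h 0
    rw [← measure_iUnion hdisj fun b => measurable_itinerary hT.measurable hP _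
      (measurableSet_singleton _)]
    have : ⋃ b, A b ⊆ T ⁻¹' (itinerary T (π ∘ f) k ⁻¹' {π ∘ v}) := by
      refine iUnion_subset fun b x hx => ?_
      simp only [A, mem_preimage, mem_singleton_iff] at hx ⊢
      rw [← itinerary_tail, hx, Fin.tail_cons]
    refine (measure_mono this).trans (le_of_eq ?_)
    exact hT.measure_preimage (measurable_itinerary hT.measurable hP _
      (measurableSet_singleton _)).nullMeasurableSet
  rw [tsum_congr h1, ← lintegral_comp_countable hf (F ∘ π)]
  change ∫⁻ x, F ((π ∘ f) x) ∂μ ≤ 1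
  rw [lintegral_comp_countable hP F]
  calc ∑' b, F b * μ ((π ∘ f) ⁻¹' {b}) ≤ ∑' b, μ (A b) / D :=
        ENNReal.tsum_le_tsum fun b => by rw [mul_comm]; exact ENNReal.mul_div_le
    _ = (∑' b, μ (A b)) / D := by simp only [div_eq_mul_inv, ENNReal.tsum_mul_right]
    _ ≤ D / D := ENNReal.div_le_div_right h2 _
    _ ≤ 1 := ENNReal.div_self_le_one

/-- After integration the first bracket becomes an entropy increment of the coarsened process and
the second the entropy lost by coarsening. -/
theorem neg_log_transitionWeight [IsProbabilityMeasure μ] (hT : MeasurePreserving T μ μ)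
    (hf : Measurable f) {m : ℕ} (π : ι → Fin m) (k : ℕ) : ∀ᵐ x ∂μ,
    0 < (transitionWeight μ T f π k (itinerary T f (k + 1) x)).toReal ∧
    -Real.log (transitionWeight μ T f π k (itinerary T f (k + 1) x)).toReal =
      (-Real.log (μ.real (itinerary T (π ∘ f) (k + 1) ⁻¹' {itinerary T (π ∘ f) (k + 1) x}))
        - -Real.log (μ.real (itinerary T (π ∘ f) k ⁻¹' {itinerary T (π ∘ f) k (T x)}))) +
      (-Real.log (μ.real (f ⁻¹' {f x})) - -Real.log (μ.real ((π ∘ f) ⁻¹' {(π ∘ f) x}))) := by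
  have hP : Measurable (π ∘ f) := (measurable_of_countable π).comp hf
  have hi := fun n => measurable_itinerary hT.measurable hP n
  filter_upwards [ae_measureReal_fiber_pos (μ := μ) (hi (k + 1)),
    hT.quasiMeasurePreserving.ae (ae_measureReal_fiber_pos (μ := μ) (hi k)),
    ae_measureReal_fiber_pos (μ := μ) hf, ae_measureReal_fiber_pos (μ := μ) hP] with x h1 h2 h3 h4
  have e : (transitionWeight μ T f π k (itinerary T f (k + 1) x)).toReal =
      μ.real (itinerary T (π ∘ f) (k + 1) ⁻¹' {itinerary T (π ∘ f) (k + 1) x}) /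
      μ.real (itinerary T (π ∘ f) k ⁻¹' {itinerary T (π ∘ f) k (T x)}) *
      (μ.real (f ⁻¹' {f x}) / μ.real ((π ∘ f) ⁻¹' {(π ∘ f) x})) := by
    simp only [transitionWeight, ENNReal.toReal_mul, ENNReal.toReal_div, itinerary_tail]
    rfl
  rw [e, Real.log_mul (by positivity) (by positivity), Real.log_div (by positivity) (by positivity),
    Real.log_div (by positivity) (by positivity)]
  exact ⟨by positivity, by ring⟩

/-- Up to a set of small measure, the space is covered by `exp (n a)` cylinders of rank `n`, for
any `a` exceeding the entropy and any partition of finite entropy. -/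
theorem eventually_exists_finset_cover [IsProbabilityMeasure μ] (hT : Ergodic T μ)
    (hf : Measurable f) (hsum : Summable fun a => Real.negMulLog (μ.real (f ⁻¹' {a}))) {a : ℝ}
    (ha : ksEntropy μ T < ENNReal.ofReal a) {δ : ℝ} (hδ : 0 < δ) :
    ∀ᶠ N : ℕ in atTop, ∃ S : Finset (Fin N → ι), (S.card : ℝ) ≤ Real.exp (N * a) ∧
      μ.real (itinerary T f N ⁻¹' (S : Set (Fin N → ι)))ᶜ ≤ δ := by
  have hmp := hT.toMeasurePreserving
  have ha0 : 0 < a := by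
    by_contra h
    rw [ENNReal.ofReal_of_nonpos (not_lt.1 h)] at ha
    exact absurd ha (not_lt.2 (zero_le))
  obtain ⟨r, hr0, hr1, hr2⟩ := ENNReal.lt_iff_exists_real_btwn.1 ha
  have hra : r < a := (ENNReal.ofReal_lt_ofReal_iff ha0).1 hr2
  -- The budget `a` is divided: `a - r` for the entropy lost by coarsening, `r` for the entropy
  -- increment of the coarsened process.
  obtain ⟨m, π, hπ⟩ := exists_finite_coarsening hsum (sub_pos.2 hra)
  have hP : Measurable (π ∘ f) := (measurable_of_countable π).comp hf
  obtain ⟨k, hk⟩ := exists_entropy_increment_lt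
    ((entropyRel_le_ksEntropy (μ := μ) (T := T) hP).trans_lt hr1)
  have hi := fun n => measurable_itinerary hmp.measurable hP n
  have hlog := neg_log_transitionWeight hmp hf π k
  have i1 := integrable_neg_log_fiber (μ := μ) (hi (k + 1)) Summable.of_finite
  have i2 := integrable_neg_log_fiber (μ := μ) (hi k) Summable.of_finite
  have i2' := hmp.integrable_comp_of_integrable i2
  have i3 := integrable_neg_log_fiber hf hsum
  have i4 := integrable_neg_log_fiber (μ := μ) hP Summable.of_finite
  have hae := hlog.mono fun x hx => hx.2
  have hint := ((i1.sub i2').add (i3.sub i4)).congr (hae.mono fun x hx => hx.symm)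
  refine eventually_exists_finset_of_markovWeight hT hf
    (tsum_transitionWeight_le hmp hf π k) (hlog.mono fun x hx => hx.1) hint ha0.le ?_ hδ
  rw [integral_congr_ae hae]
  have e1 := integral_add (i1.sub i2') (i3.sub i4)
  have e2 := integral_sub i1 i2'
  have e3 := integral_sub i3 i4
  have e4 := integral_comp_iterate hmp i2 1
  rw [integral_neg_log_fiber hf hsum, integral_neg_log_fiber_fintype hP] at e3
  simp only [Function.iterate_one] at e4
  rw [integral_neg_log_fiber_fintype (hi (k + 1))] at e2
  rw [integral_neg_log_fiber_fintype (hi k)] at e4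
  simp only [Pi.sub_apply, Function.comp] at e1 e2 e3 e4 hπ ⊢
  rw [e1, e2, e3, e4]
  simp only [Function.comp_def] at hk hπ ⊢
  linarith

end EntropyCover

/-! ### Cylinders are small: the lower half of the Shannon–McMillan theorem -/

section TruncatedLog

/-- The function `min (-log t) M` for `t > 0`, extended by `M` to `t ≤ 0`. -/
def truncLog (M t : ℝ) : ℝ := -Real.log (max t (Real.exp (-M)))

theorem measurable_truncLog (M : ℝ) : Measurable (truncLog M) :=
  (Real.measurable_log.comp (measurable_id.max measurable_const)).neg

/-- On `[exp (-M), ∞)` the logarithm is Lipschitz with constant `exp M`, and taking the maximum with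
`exp (-M)` does not increase distances. -/
theorem abs_truncLog_sub_le (M s t : ℝ) :
    |truncLog M s - truncLog M t| ≤ Real.exp M * |s - t| := by
  have key : ∀ a b : ℝ, 0 < a → Real.exp (-M) ≤ b →
      Real.log a - Real.log b ≤ Real.exp M * |a - b| := by
    intro a b ha hb
    have hb0 : 0 < b := (Real.exp_pos _).trans_le hb
    rw [← Real.log_div ha.ne' hb0.ne']
    have h1 := Real.log_le_sub_one_of_pos (div_pos ha hb0)
    have h2 : a / b - 1 = b⁻¹ * (a - b) := by field_simp
    have h3 : b⁻¹ ≤ Real.exp M := by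
      rw [inv_le_comm₀ hb0 (Real.exp_pos _), ← Real.exp_neg]
      exact hb
    calc Real.log (a / b) ≤ b⁻¹ * (a - b) := h2 ▸ h1
      _ ≤ b⁻¹ * |a - b| := by gcongr; exact le_abs_self _
      _ ≤ _ := by gcongr
  have hp : ∀ u : ℝ, 0 < max u (Real.exp (-M)) :=
    fun u => (Real.exp_pos _).trans_le (le_max_right _ _)
  have h1 := key _ _ (hp s) (le_max_right t (Real.exp (-M)))
  have h2 := key _ _ (hp t) (le_max_right s (Real.exp (-M)))
  have h3 : |max s (Real.exp (-M)) - max t (Real.exp (-M))| ≤ |s - t| := by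
    simpa using abs_max_sub_max_le_max s (Real.exp (-M)) t (Real.exp (-M))
  have h4 := mul_le_mul_of_nonneg_left h3 (Real.exp_pos M).le
  rw [abs_sub_comm (max t _)] at h2
  unfold truncLog
  rw [abs_le]
  constructor <;> linarith

theorem truncLog_le {M t : ℝ} (ht : 0 < t) : truncLog M t ≤ -Real.log t :=
  neg_le_neg (Real.log_le_log ht (le_max_left _ _))

/-- Below the truncation level this is `log u ≤ u - 1` at `u = exp (-M) / t`. The error is linear in
`t⁻¹` because the inverse letter probabilities have integrals bounded uniformly in `n`. -/
theorem neg_log_le_truncLog_add {M t : ℝ} (ht : 0 < t) :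
    -Real.log t ≤ truncLog M t + Real.exp (-M) * t⁻¹ := by
  unfold truncLog
  rcases le_total t (Real.exp (-M)) with h | h
  · rw [max_eq_right h, Real.log_exp, neg_neg]
    have h1 := Real.log_le_sub_one_of_pos (mul_pos (Real.exp_pos (-M)) (inv_pos.2 ht))
    rw [Real.log_mul (Real.exp_pos _).ne' (inv_pos.2 ht).ne', Real.log_exp, Real.log_inv] at h1
    linarith
  · rw [max_eq_left h]
    have : 0 < Real.exp (-M) * t⁻¹ := by positivity
    linarith

theorem abs_truncLog_le {M t : ℝ} (hM : 0 ≤ M) (ht : t ≤ 1) : |truncLog M t| ≤ M := by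
  unfold truncLog
  have h1 : max t (Real.exp (-M)) ≤ 1 := max_le ht (Real.exp_le_one_iff.2 (by linarith))
  have h2 := Real.log_le_log (Real.exp_pos _) (le_max_right t (Real.exp (-M)))
  rw [Real.log_exp] at h2
  have h3 := Real.log_nonpos ((Real.exp_pos _).le.trans (le_max_right t (Real.exp (-M)))) h1
  rw [abs_le]
  constructor <;> linarith

end TruncatedLog

/-! ### Conditional probabilities given a finite partition. -/

section CondExpFinite

variable {X : Type*} [MeasurableSpace X] {μ : Measure X} [IsFiniteMeasure μ]
  {κ : Type*} [Fintype κ] [MeasurableSpace κ] [DiscreteMeasurableSpace κ] {g : X → κ}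

/-- Conditional expectation of an indicator with respect to a finite partition. -/
theorem condProb_fiber_ae_eq_condExp (hg : Measurable g) {A : Set X} (hA : MeasurableSet A) :
    (fun x => μ.real (A ∩ g ⁻¹' {g x}) / μ.real (g ⁻¹' {g x})) =ᵐ[μ]
      μ[A.indicator (fun _ => (1 : ℝ)) | MeasurableSpace.comap g inferInstance] := by
  classical
  set Φ : κ → ℝ := fun w => μ.real (A ∩ g ⁻¹' {w}) / μ.real (g ⁻¹' {w})
  have hint : ∀ F : κ → ℝ, Integrable (fun x => F (g x)) μ :=
    fun F => integrable_comp_countable hg Summable.of_finite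
  refine ae_eq_condExp_of_forall_setIntegral_eq hg.comap_le
    ((integrable_const (1 : ℝ)).indicator hA) (fun s _ _ => (hint Φ).integrableOn) ?_ ?_
  · rintro _ ⟨W, _, rfl⟩ _
    have hW : MeasurableSet (g ⁻¹' W) := measurableSet_preimage_discrete hg W
    have e1 : ∫ x in g ⁻¹' W, Φ (g x) ∂μ = ∫ x, W.indicator Φ (g x) ∂μ := by
      rw [← integral_indicator hW]
      rfl
    have e2 : ∫ x in g ⁻¹' W, A.indicator (fun _ => (1 : ℝ)) x ∂μ
        = ∫ x, W.indicator (fun _ => (1 : ℝ)) (g x) ∂(μ.restrict A) := by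
      rw [← integral_indicator hW, ← integral_indicator hA]
      refine integral_congr_ae (Eventually.of_forall fun x => ?_)
      by_cases h1 : x ∈ A <;> by_cases h2 : g x ∈ W <;> simp [indicator, h1, h2]
    rw [e1, e2, integral_comp_countable hg (hint _),
      integral_comp_countable hg (integrable_comp_countable hg Summable.of_finite),
      tsum_fintype, tsum_fintype]
    refine Finset.sum_congr rfl fun w _ => ?_
    by_cases hw : w ∈ W
    · simp only [indicator_of_mem hw, mul_one, Φ]
      rw [measureReal_restrict_apply (hg (measurableSet_singleton w)), inter_comm]
      -- On a null fibre both sides vanish, whatever the value of the quotient.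
      by_cases h0 : μ.real (g ⁻¹' {w}) = 0
      · rw [h0, zero_mul]
        exact (measureReal_mono_null inter_subset_left h0).symm
      · rw [inter_comm]
        field_simp
    · simp [indicator_of_notMem hw]
  · have : @Measurable _ _ (MeasurableSpace.comap g inferInstance) _ (fun x => Φ (g x)) :=
      (measurable_of_countable Φ).comp (comap_measurable g)
    exact this.stronglyMeasurable.aestronglyMeasurable

end CondExpFinite

/-! ### Conditional letter probabilities and their limit. -/

section ShannonMcMillan

variable {X : Type*} {T : X → X} {ι : Type*} {f : X → ι}

theorem preimage_itinerary_succ (n : ℕ) (w : Fin (n + 1) → ι) :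
    itinerary T f (n + 1) ⁻¹' {w} = f ⁻¹' {w 0} ∩ T ⁻¹' (itinerary T f n ⁻¹' {Fin.tail w}) := by
  ext x
  simp only [mem_preimage, mem_singleton_iff, mem_inter_iff, itinerary_succ]
  constructor
  · rintro rfl; simp
  · rintro ⟨h1, h2⟩
    rw [h1, h2, Fin.cons_self_tail]

variable [MeasurableSpace X] {μ : Measure X}

/-- The measure of the cylinder of rank `n` containing `x`. -/
def cylProb (μ : Measure X) (T : X → X) (f : X → ι) (n : ℕ) (x : X) : ℝ :=
  μ.real (itinerary T f n ⁻¹' {itinerary T f n x})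

/-- The conditional probability of the first letter of the itinerary of `x` given the following
`n` letters. -/
def letterProb (μ : Measure X) (T : X → X) (f : X → ι) (n : ℕ) (x : X) : ℝ :=
  cylProb μ T f (n + 1) x / cylProb μ T f n (T x)

/-- The chain rule, conditioning on the future: within the word, the letter at time `j` is followed
by `n - 1 - j` letters. The point is quantified inside because the induction passes to `T x`. -/
theorem neg_log_cylProb [IsProbabilityMeasure μ] (n : ℕ) : ∀ x : X,
    (∀ m j, 0 < cylProb μ T f m (T^[j] x)) →
    -Real.log (cylProb μ T f n x) =
      ∑ j ∈ Finset.range n, -Real.log (letterProb μ T f (n - 1 - j) (T^[j] x)) := by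
  induction n with
  | zero =>
    intro x _
    have : itinerary T f 0 ⁻¹' {itinerary T f 0 x} = univ :=
      eq_univ_of_forall fun y => Subsingleton.elim _ _
    simp [cylProb, this]
  | succ n ih =>
    intro x hx
    have h1 := ih (T x) fun m j => by simpa using hx m (j + 1)
    have hx0 := fun m => hx m 0
    have hx1 := fun m => hx m 1
    simp only [Function.iterate_zero, Function.iterate_one, _root_.id] at hx0 hx1
    rw [Finset.sum_range_succ']
    simp only [Function.iterate_succ_apply, Function.iterate_zero, _root_.id]
    have h2 : ∀ j, n + 1 - 1 - (j + 1) = n - 1 - j := fun j => by omega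
    simp only [h2, ← h1]
    simp only [Nat.add_sub_cancel, Nat.sub_zero]
    rw [letterProb, Real.log_div (hx0 _).ne' (hx1 _).ne']
    ring

theorem letterProb_nonneg (n : ℕ) (x : X) : 0 ≤ letterProb μ T f n x :=
  div_nonneg measureReal_nonneg measureReal_nonneg

variable [Fintype ι] [MeasurableSpace ι] [DiscreteMeasurableSpace ι]

theorem measurable_cylProb (hT : Measurable T) (hf : Measurable f) (n : ℕ) :
    Measurable (cylProb μ T f n) :=
  (measurable_of_countable fun w => μ.real (itinerary T f n ⁻¹' {w})).comp
    (measurable_itinerary hT hf n)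

theorem measurable_letterProb (hT : Measurable T) (hf : Measurable f) (n : ℕ) :
    Measurable (letterProb μ T f n) :=
  (measurable_cylProb hT hf _).div ((measurable_cylProb hT hf _).comp hT)

theorem letterProb_le_one [IsProbabilityMeasure μ] (hT : MeasurePreserving T μ μ)
    (hf : Measurable f) (n : ℕ) (x : X) : letterProb μ T f n x ≤ 1 := by
  refine div_le_one_of_le₀ ?_ measureReal_nonneg
  unfold cylProb
  rw [preimage_itinerary_succ, itinerary_tail]
  refine (measureReal_mono inter_subset_right).trans (le_of_eq ?_)
  exact hT.measureReal_preimage (measurable_itinerary hT.measurable hf _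
    (measurableSet_singleton _)).nullMeasurableSet

theorem ae_cylProb_pos [IsProbabilityMeasure μ] (hT : MeasurePreserving T μ μ)
    (hf : Measurable f) : ∀ᵐ x ∂μ, ∀ m j, 0 < cylProb μ T f m (T^[j] x) :=
  ae_all_iff.2 fun m => ae_all_iff.2 fun j => (hT.iterate j).quasiMeasurePreserving.ae
    (ae_measureReal_fiber_pos (measurable_itinerary hT.measurable hf m))

/-- The measure of a cylinder divided by its conditional probability is the measure of its tail, and
each tail extends in `card ι` ways. The bound is independent of `n`, which makes the truncation
error uniform. -/
theorem integral_inv_letterProb_le [IsProbabilityMeasure μ] (hT : Measurable T)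
    (hf : Measurable f) (n : ℕ) :
    Integrable (fun x => (letterProb μ T f n x)⁻¹) μ ∧
    ∫ x, (letterProb μ T f n x)⁻¹ ∂μ ≤ Fintype.card ι := by
  have hm := fun n => measurable_itinerary hT hf n
  let p : (n : ℕ) → (Fin n → ι) → ℝ := fun n w => μ.real (itinerary T f n ⁻¹' {w})
  let F : (Fin (n + 1) → ι) → ℝ := fun w => (p (n + 1) w / p n (Fin.tail w))⁻¹
  have hF : (fun x => (letterProb μ T f n x)⁻¹) = fun x => F (itinerary T f (n + 1) x) := by
    funext x
    simp only [F, p, letterProb, cylProb, itinerary_tail]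
  have hi : Integrable (fun x => F (itinerary T f (n + 1) x)) μ :=
    integrable_comp_countable (hm _) Summable.of_finite
  rw [hF]
  refine ⟨hi, ?_⟩
  rw [integral_comp_countable (hm _) hi, tsum_fintype]
  have hsum1 : ∑ w, p n w = 1 := by
    have := integral_comp_countable (μ := μ) (F := fun _ => (1 : ℝ)) (hm n) (integrable_const _)
    simpa using this.symm
  calc ∑ w, p (n + 1) w * F w ≤ ∑ w : Fin (n + 1) → ι, p n (Fin.tail w) := by
        refine Finset.sum_le_sum fun w _ => ?_
        simp only [F, inv_div]
        rcases eq_or_ne (p (n + 1) w) 0 with h | h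
        · rw [h, zero_mul]
          exact measureReal_nonneg
        · rw [mul_div_cancel₀ _ h]
    _ = ∑ a : ι, ∑ w, p n w := by
        rw [← (Fin.consEquiv fun _ : Fin (n + 1) => ι).sum_comp, Fintype.sum_prod_type]
        rfl
    _ = Fintype.card ι := by simp [hsum1]

/-- The conditional probabilities `letterProb` converge in `L¹`. -/
theorem exists_tendsto_letterProb [IsProbabilityMeasure μ] (hT : MeasurePreserving T μ μ)
    (hf : Measurable f) : ∃ q : X → ℝ, Integrable q μ ∧
      Tendsto (fun n => ∫ x, |letterProb μ T f n x - q x| ∂μ) atTop (𝓝 0) := by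
  classical
  have hm : ∀ n, Measurable fun x => itinerary T f n (T x) :=
    fun n => (measurable_itinerary hT.measurable hf n).comp hT.measurable
  -- The algebras are generated by the letters at times `1, …, n`, so they increase with `n` and
  -- Lévy's upward theorem applies.
  let ℱ : Filtration ℕ (inferInstance : MeasurableSpace X) :=
    { seq := fun n => MeasurableSpace.comap (fun x => itinerary T f n (T x)) inferInstance
      mono' := by
        intro m n hmn
        have : (fun x => itinerary T f m (T x)) =
            (fun (w : Fin n → ι) (i : Fin m) => w (Fin.castLE hmn i)) ∘
              fun x => itinerary T f n (T x) := rfl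
        simp only
        rw [this, ← MeasurableSpace.comap_comp]
        exact MeasurableSpace.comap_mono (Measurable.comap_le .of_discrete)
      le' := fun n => (hm n).comap_le }
  let A : ι → Set X := fun a => f ⁻¹' {a}
  have hA : ∀ a, MeasurableSet (A a) := fun a => hf (measurableSet_singleton a)
  let c : ι → ℕ → X → ℝ := fun a n => μ[(A a).indicator (fun _ => (1 : ℝ)) | ℱ n]
  let c' : ι → X → ℝ := fun a => μ[(A a).indicator (fun _ => (1 : ℝ)) | ⨆ n, ℱ n]
  have hlim : ∀ a, Tendsto (fun n => ∫ x, |c a n x - c' a x| ∂μ) atTop (𝓝 0) := by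
    intro a
    have h := (ENNReal.tendsto_toReal ENNReal.zero_ne_top).comp
      (tendsto_eLpNorm_condExp (μ := μ) (ℱ := ℱ) ((A a).indicator (fun _ => (1 : ℝ))))
    refine h.congr fun n => ?_
    have hi : Integrable (c a n - c' a) μ := integrable_condExp.sub integrable_condExp
    simp only [Function.comp]
    rw [eLpNorm_one_eq_lintegral_enorm, ← integral_norm_eq_lintegral_enorm hi.aestronglyMeasurable]
    rfl
  -- At each point only the term of its own letter survives, so `letterProb` is glued from finitely
  -- many conditional expectations.
  have hq : ∀ n, letterProb μ T f n =ᵐ[μ] fun x => ∑ a, (A a).indicator (c a n) x := by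
    intro n
    have hc : ∀ a, (fun x => μ.real (A a ∩ (fun x => itinerary T f n (T x)) ⁻¹'
        {itinerary T f n (T x)}) / μ.real ((fun x => itinerary T f n (T x)) ⁻¹'
        {itinerary T f n (T x)})) =ᵐ[μ] c a n :=
      fun a => condProb_fiber_ae_eq_condExp (hm n) (hA a)
    filter_upwards [ae_all_iff.2 hc] with x hx
    rw [Finset.sum_eq_single (f x)]
    · rw [indicator_of_mem (show x ∈ A (f x) from rfl), ← hx]
      simp only [letterProb, cylProb]
      rw [preimage_itinerary_succ, itinerary_tail]
      have e := hT.measureReal_preimage (measurable_itinerary hT.measurable hf n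
        (measurableSet_singleton (itinerary T f n (T x)))).nullMeasurableSet
      rw [← e]
      rfl
    · intro a _ ha
      exact indicator_of_notMem (s := A a) (fun h : f x = a => ha h.symm) (c a n)
    · simp
  have hci : ∀ a, Integrable ((A a).indicator (c' a)) μ :=
    fun a => integrable_condExp.indicator (hA a)
  refine ⟨fun x => ∑ a, (A a).indicator (c' a) x, integrable_finsetSum _ fun a _ => hci a, ?_⟩
  have hlim2 := tendsto_finsetSum Finset.univ fun a _ => hlim a
  simp only [Finset.sum_const_zero] at hlim2
  refine squeeze_zero (fun n => integral_nonneg fun x => abs_nonneg _) (fun n => ?_) hlim2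
  have hi : ∀ a, Integrable (fun x => |c a n x - c' a x|) μ :=
    fun a => (integrable_condExp.sub integrable_condExp).abs
  rw [← integral_finsetSum _ fun a _ => hi a]
  refine integral_mono_of_nonneg (Eventually.of_forall fun x => abs_nonneg _)
    (integrable_finsetSum _ fun a _ => hi a) ?_
  filter_upwards [hq n] with x hx
  rw [hx, ← Finset.sum_sub_distrib]
  refine (Finset.abs_sum_le_sum_abs _ _).trans (Finset.sum_le_sum fun a _ => ?_)
  by_cases h : x ∈ A a
  · simp [indicator_of_mem h]
  · simp [indicator_of_notMem h]

end ShannonMcMillan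

/-! ### Exponentially small cylinders for finite partitions. -/

section ShannonMcMillanLower

variable {X : Type*} {T : X → X} [MeasurableSpace X] {μ : Measure X} [IsProbabilityMeasure μ]
  {ι : Type*} {f : X → ι} [Fintype ι] [MeasurableSpace ι] [DiscreteMeasurableSpace ι]

theorem integrable_truncLog_letterProb (hT : MeasurePreserving T μ μ) (hf : Measurable f) {M : ℝ}
    (hM : 0 ≤ M) (n : ℕ) : Integrable (fun x => truncLog M (letterProb μ T f n x)) μ :=
  Integrable.of_bound ((measurable_truncLog M).comp
    (measurable_letterProb hT.measurable hf n)).aestronglyMeasurable M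
    (Eventually.of_forall fun x => abs_truncLog_le hM (letterProb_le_one hT hf n x))

/-- Integrate the chain rule with each logarithm replaced by its truncation plus the error term;
invariance removes the iterates. -/
theorem partitionEntropy_itinerary_le (hT : MeasurePreserving T μ μ) (hf : Measurable f) {M : ℝ}
    (hM : 0 ≤ M) (n : ℕ) :
    partitionEntropy μ (itinerary T f n) ≤
      ∑ j ∈ Finset.range n, (∫ x, truncLog M (letterProb μ T f j x) ∂μ
        + Real.exp (-M) * Fintype.card ι) := by
  have hm := fun n => measurable_itinerary hT.measurable hf n
  have hi := fun n => integrable_truncLog_letterProb hT hf hM n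
  have hinv := fun n => integral_inv_letterProb_le (μ := μ) hT.measurable hf n
  let b : ℕ → X → ℝ := fun n x =>
    truncLog M (letterProb μ T f n x) + Real.exp (-M) * (letterProb μ T f n x)⁻¹
  have hb : ∀ n, Integrable (b n) μ := fun n => (hi n).add ((hinv n).1.const_mul _)
  rw [← integral_neg_log_fiber_fintype (hm n), ← Finset.sum_range_reflect]
  have hae : ∀ᵐ x ∂μ, -Real.log (μ.real (itinerary T f n ⁻¹' {itinerary T f n x})) ≤
      ∑ j ∈ Finset.range n, b (n - 1 - j) (T^[j] x) := by
    filter_upwards [ae_cylProb_pos hT hf] with x hx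
    have := neg_log_cylProb n x hx
    rw [cylProb] at this
    rw [this]
    refine Finset.sum_le_sum fun j _ => neg_log_le_truncLog_add ?_
    have h2 := hx (n - 1 - j) (j + 1)
    rw [Function.iterate_succ_apply'] at h2
    exact div_pos (hx _ _) h2
  have hbj : ∀ j, Integrable (fun x => b (n - 1 - j) (T^[j] x)) μ :=
    fun j => (hT.iterate j).integrable_comp_of_integrable (hb _)
  refine (integral_mono_ae (integrable_neg_log_fiber (hm n) Summable.of_finite)
    (integrable_finsetSum _ fun j _ => hbj j) hae).trans ?_
  rw [integral_finsetSum _ fun j _ => hbj j]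
  refine Finset.sum_le_sum fun j _ => ?_
  rw [integral_comp_iterate hT (hb _)]
  simp only [b]
  rw [integral_add (hi _) ((hinv _).1.const_mul _), integral_const_mul]
  gcongr
  exact (hinv _).2

/-- **Shannon–McMillan theorem**, lower bound: below the entropy of a finite partition, the
cylinders of rank `n` have exponentially small measure around most points. -/
theorem tendsto_measureReal_exp_le_cylProb (hT : Ergodic T μ) (hf : Measurable f) {b : ℝ}
    (hb : 0 ≤ b) (hlt : ENNReal.ofReal b < entropyRel μ T f) :
    Tendsto (fun n : ℕ => μ.real {x | Real.exp (-(n * b)) ≤ cylProb μ T f n x}) atTop (𝓝 0) := by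
  have hmp := hT.toMeasurePreserving
  obtain ⟨r, hr0, hr1, hr2⟩ := ENNReal.lt_iff_exists_real_btwn.1 hlt
  have hbr : b < r := (ENNReal.ofReal_lt_ofReal_iff_of_nonneg hb).1 hr1
  obtain ⟨q, hqi, hq⟩ := exists_tendsto_letterProb hmp hf
  set c := (r - b) / 2 with hc
  have hc0 : 0 < c := by simp only [hc]; linarith
  -- The truncation error is kept below half of the gap `r - b`; the other half is the deviation
  -- allowed from the mean.
  obtain ⟨M, hM0, hM⟩ : ∃ M : ℝ, 0 ≤ M ∧ Real.exp (-M) * Fintype.card ι < c := by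
    have h1 : Tendsto (fun M : ℝ => Real.exp (-M) * Fintype.card ι) atTop (𝓝 (0 * _)) :=
      (Real.tendsto_exp_neg_atTop_nhds_zero).mul_const _
    rw [zero_mul] at h1
    exact ((eventually_ge_atTop 0).and (h1.eventually_lt_const hc0)).exists
  let Ψ : X → ℝ := fun x => truncLog M (q x)
  let g : ℕ → X → ℝ := fun n x => truncLog M (letterProb μ T f n x)
  have hgi : ∀ n, Integrable (g n) μ := fun n => integrable_truncLog_letterProb hmp hf hM0 n
  have hlp : ∀ n, Integrable (letterProb μ T f n) μ := fun n =>
    Integrable.of_bound (measurable_letterProb hmp.measurable hf n).aestronglyMeasurable 1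
      (Eventually.of_forall fun x => by
        rw [Real.norm_eq_abs, abs_of_nonneg (letterProb_nonneg n x)]
        exact letterProb_le_one hmp hf n x)
  have hΨm : AEStronglyMeasurable Ψ μ :=
    ((measurable_truncLog M).comp_aemeasurable hqi.aemeasurable).aestronglyMeasurable
  have hdiff : ∀ n, Integrable (fun x => g n x - Ψ x) μ := fun n =>
    (((hlp n).sub hqi).abs.const_mul (Real.exp M)).mono' ((hgi n).aestronglyMeasurable.sub hΨm)
      (Eventually.of_forall fun x => abs_truncLog_sub_le M _ _)
  have hΨi : Integrable Ψ μ := by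
    have := (hgi 0).sub (hdiff 0)
    refine this.congr (Eventually.of_forall fun x => ?_)
    simp
  set d : ℕ → ℝ := fun n => ∫ x, |g n x - Ψ x| ∂μ with hd
  have hdlim : Tendsto d atTop (𝓝 0) := by
    have h1 := hq.const_mul (Real.exp M)
    rw [mul_zero] at h1
    refine squeeze_zero (fun n => integral_nonneg fun x => abs_nonneg _) (fun n => ?_) h1
    rw [← integral_const_mul]
    exact integral_mono (hdiff n).abs (((hlp n).sub hqi).abs.const_mul (Real.exp M))
      fun x => abs_truncLog_sub_le M _ _
  set L := ∫ x, Ψ x ∂μ with hL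
  have hglim : Tendsto (fun n => ∫ x, g n x ∂μ) atTop (𝓝 L) := by
    rw [tendsto_iff_norm_sub_tendsto_zero]
    refine squeeze_zero (fun n => norm_nonneg _) (fun n => ?_) hdlim
    rw [hL, ← integral_sub (hgi n) hΨi]
    exact abs_integral_le_integral_abs
  -- Otherwise the Cesàro means that bound `H_n / n` would eventually stay below `r`, against `r <
  -- h(T, P)`.
  have hLr : r ≤ L + Real.exp (-M) * Fintype.card ι := by
    by_contra! hcon
    have h1 := (hglim.add_const (Real.exp (-M) * Fintype.card ι)).cesaro
    refine absurd hr2 (not_lt.2 (limsup_le_of_le (h := ?_)))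
    filter_upwards [h1.eventually_lt_const hcon] with n hn
    refine ENNReal.ofReal_le_ofReal (le_trans ?_ hn.le)
    rw [div_eq_inv_mul]
    exact mul_le_mul_of_nonneg_left (partitionEntropy_itinerary_le hmp hf hM0 n) (by positivity)
  have hdc := hdlim.cesaro
  have herg := tendsto_integral_abs_birkhoffAverage_sub hT hΨi
  have hsum := (hdc.add herg).const_mul c⁻¹
  simp only [add_zero, mul_zero] at hsum
  refine squeeze_zero' (Eventually.of_forall fun n => measureReal_nonneg) ?_ hsum
  filter_upwards [eventually_gt_atTop 0] with n hn
  have hn' : (0 : ℝ) < n := by exact_mod_cast hn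
  set S : X → ℝ := fun x => (n : ℝ)⁻¹ * ∑ j ∈ Finset.range n, g (n - 1 - j) (T^[j] x) with hS
  have hgj : ∀ j, Integrable (fun x => g (n - 1 - j) (T^[j] x)) μ :=
    fun j => (hmp.iterate j).integrable_comp_of_integrable (hgi _)
  have hSi : Integrable S μ := (integrable_finsetSum _ fun j _ => hgj j).const_mul _
  have hsub : ({x | Real.exp (-(n * b)) ≤ cylProb μ T f n x} : Set X) ≤ᵐ[μ]
      ({x | c ≤ |S x - L|} : Set X) := by
    filter_upwards [ae_cylProb_pos hmp hf] with x hx hxb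
    have hxb' : Real.exp (-(n * b)) ≤ cylProb μ T f n x := hxb
    change c ≤ |S x - L|
    have h1 := neg_log_cylProb n x hx
    have h2 : ∑ j ∈ Finset.range n, g (n - 1 - j) (T^[j] x) ≤ n * b := by
      calc _ ≤ -Real.log (cylProb μ T f n x) := by
            rw [h1]
            refine Finset.sum_le_sum fun j _ => truncLog_le ?_
            have h2 := hx (n - 1 - j) (j + 1)
            rw [Function.iterate_succ_apply'] at h2
            exact div_pos (hx _ _) h2
        _ ≤ -Real.log (Real.exp (-(n * b))) := neg_le_neg (Real.log_le_log (Real.exp_pos _) hxb')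
        _ = n * b := by rw [Real.log_exp, neg_neg]
    have h3 : S x ≤ b := by
      simp only [hS]
      rwa [inv_mul_le_iff₀ hn']
    rw [abs_sub_comm]
    refine le_trans ?_ (le_abs_self _)
    have : r = b + 2 * c := by simp only [hc]; ring
    linarith
  have h1 : μ.real {x | Real.exp (-(n * b)) ≤ cylProb μ T f n x} ≤ μ.real {x | c ≤ |S x - L|} :=
    ENNReal.toReal_mono (measure_ne_top _ _) (measure_mono_ae hsub)
  have h2 := mul_measureReal_ge_abs_le_integral_abs (hSi.sub (integrable_const L)) c
  have hdj : ∀ j, Integrable (fun x => |g (n - 1 - j) (T^[j] x) - Ψ (T^[j] x)|) μ :=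
    fun j => ((hmp.iterate j).integrable_comp_of_integrable (hdiff _)).abs
  have hB : Integrable (fun x => |birkhoffAverage ℝ T Ψ n x - L|) μ :=
    ((integrable_birkhoffAverage hmp hΨi n).sub (integrable_const L)).abs
  have h3 : ∫ x, |S x - L| ∂μ ≤ (n : ℝ)⁻¹ * ∑ j ∈ Finset.range n, d j
      + ∫ x, |birkhoffAverage ℝ T Ψ n x - L| ∂μ := by
    have hsd : Integrable (fun x => (n : ℝ)⁻¹ *
        ∑ j ∈ Finset.range n, |g (n - 1 - j) (T^[j] x) - Ψ (T^[j] x)|) μ :=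
      (integrable_finsetSum _ fun j _ => hdj j).const_mul _
    have e : (n : ℝ)⁻¹ * ∑ j ∈ Finset.range n, d j = ∫ x, (n : ℝ)⁻¹ *
        ∑ j ∈ Finset.range n, |g (n - 1 - j) (T^[j] x) - Ψ (T^[j] x)| ∂μ := by
      rw [integral_const_mul, integral_finsetSum _ fun j _ => hdj j, ← Finset.sum_range_reflect]
      congr 1
      refine Finset.sum_congr rfl fun j _ => ?_
      exact (integral_comp_iterate hmp (hdiff (n - 1 - j)).abs j).symm
    rw [e, ← integral_add hsd hB]
    refine integral_mono (hSi.sub (integrable_const L)).abs (hsd.add hB) fun x => ?_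
    -- Maker's device: replacing the time-dependent functions by their limit `Ψ` leaves a Cesàro
    -- mean of `L¹` distances and an ordinary Birkhoff average.
    have e2 : S x - L = (n : ℝ)⁻¹ * ∑ j ∈ Finset.range n, (g (n - 1 - j) (T^[j] x) - Ψ (T^[j] x))
        + (birkhoffAverage ℝ T Ψ n x - L) := by
      simp only [hS, birkhoffAverage, birkhoffSum, smul_eq_mul, Finset.sum_sub_distrib]
      ring
    simp only
    rw [e2]
    refine (abs_add_le _ _).trans (add_le_add_left ?_ _)
    rw [abs_mul, abs_of_pos (inv_pos.2 hn')]
    exact mul_le_mul_of_nonneg_left (Finset.abs_sum_le_sum_abs _ _) (inv_pos.2 hn').le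
  rw [le_inv_mul_iff₀ hc0]
  calc _ ≤ c * μ.real {x | c ≤ |S x - L|} := mul_le_mul_of_nonneg_left h1 hc0.le
    _ ≤ _ := h2
    _ ≤ _ := h3

/-- Below the entropy of a finite partition, `exp (n b)` cylinders of rank `n` cover little. -/
theorem eventually_measureReal_preimage_finset_le (hT : Ergodic T μ) (hf : Measurable f) {b : ℝ}
    (hb : 0 ≤ b) (hlt : ENNReal.ofReal b < entropyRel μ T f) {δ : ℝ} (hδ : 0 < δ) :
    ∀ᶠ n : ℕ in atTop, ∀ S : Finset (Fin n → ι), (S.card : ℝ) ≤ Real.exp (n * b) →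
      μ.real (itinerary T f n ⁻¹' S) ≤ δ := by
  obtain ⟨r, hr0, hr1, hr2⟩ := ENNReal.lt_iff_exists_real_btwn.1 hlt
  have hbr : b < r := (ENNReal.ofReal_lt_ofReal_iff_of_nonneg hb).1 hr1
  have h1 : Tendsto (fun n : ℕ => Real.exp (-(n * (r - b)))) atTop (𝓝 0) := by
    refine Real.tendsto_exp_neg_atTop_nhds_zero.comp ?_
    exact tendsto_natCast_atTop_atTop.atTop_mul_const (sub_pos.2 hbr)
  filter_upwards [(tendsto_measureReal_exp_le_cylProb hT hf hr0 hr2).eventually_lt_const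
    (half_pos hδ), h1.eventually_lt_const (half_pos hδ)] with n hn1 hn2 S hS
  classical
  -- Points in large cylinders are rare by the lower Shannon–McMillan bound; the small cylinders
  -- number at most `exp (n b)` and weigh less than `exp (-n r)` each.
  have hsub : itinerary T f n ⁻¹' S ⊆ {x | Real.exp (-(n * r)) ≤ cylProb μ T f n x} ∪
      ⋃ w ∈ S.filter (fun w => μ.real (itinerary T f n ⁻¹' {w}) < Real.exp (-(n * r))),
        itinerary T f n ⁻¹' {w} := by
    intro x hx
    by_cases h : Real.exp (-(n * r)) ≤ cylProb μ T f n x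
    · exact Or.inl h
    · refine Or.inr (mem_iUnion₂.2 ⟨itinerary T f n x, ?_, rfl⟩)
      exact Finset.mem_filter.2 ⟨hx, not_le.1 h⟩
  calc μ.real (itinerary T f n ⁻¹' S) ≤ _ := measureReal_mono hsub
    _ ≤ _ := measureReal_union_le _ _
    _ ≤ δ / 2 + S.card * Real.exp (-(n * r)) := by
        refine add_le_add hn1.le ((measureReal_biUnion_finset_le _ _).trans ?_)
        calc _ ≤ ∑ w ∈ S.filter (fun w => μ.real (itinerary T f n ⁻¹' {w}) < Real.exp (-(n * r))),
              Real.exp (-(n * r)) := Finset.sum_le_sum fun w hw => (Finset.mem_filter.1 hw).2.le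
          _ ≤ _ := by
              rw [Finset.sum_const, nsmul_eq_mul]
              gcongr
              exact Finset.filter_subset _ _
    _ ≤ δ / 2 + Real.exp (n * b) * Real.exp (-(n * r)) := by gcongr
    _ ≤ δ := by
        rw [← Real.exp_add]
        have : (n : ℝ) * b + -(n * r) = -(n * (r - b)) := by ring
        rw [this]
        linarith

end ShannonMcMillanLower

/-! ### Approximation by cylinder sets -/

section Approximation

variable {X : Type*} {T : X → X} {ι : Type*} {f : X → ι}

theorem exists_preimage_itinerary_eq {l l' : ℕ} (h : l ≤ l') (W : Set (Fin l → ι)) :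
    ∃ W' : Set (Fin l' → ι), itinerary T f l' ⁻¹' W' = itinerary T f l ⁻¹' W :=
  ⟨{w | (fun i : Fin l => w (Fin.castLE h i)) ∈ W}, rfl⟩

variable [MeasurableSpace X] {μ : Measure X}

/-- `A` is measurable and is approximated in measure by unions of cylinders of finite rank. -/
def CylinderApprox (μ : Measure X) (T : X → X) (f : X → ι) (A : Set X) : Prop :=
  MeasurableSet A ∧ ∀ ε > 0, ∃ l : ℕ, ∃ W : Set (Fin l → ι),
    μ.real (symmDiff A (itinerary T f l ⁻¹' W)) ≤ ε

theorem CylinderApprox.exists_le {A : Set X} (hA : CylinderApprox μ T f A) {ε : ℝ} (hε : 0 < ε) :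
    ∃ l₀ : ℕ, ∀ l ≥ l₀, ∃ W : Set (Fin l → ι),
      μ.real (symmDiff A (itinerary T f l ⁻¹' W)) ≤ ε := by
  obtain ⟨l₀, W, hW⟩ := hA.2 ε hε
  refine ⟨l₀, fun l hl => ?_⟩
  obtain ⟨W', hW'⟩ := exists_preimage_itinerary_eq (T := T) (f := f) hl W
  exact ⟨W', hW'.symm ▸ hW⟩

theorem cylinderApprox_preimage {l : ℕ} (W : Set (Fin l → ι))
    (h : MeasurableSet (itinerary T f l ⁻¹' W)) : CylinderApprox μ T f (itinerary T f l ⁻¹' W) :=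
  ⟨h, fun ε hε => ⟨l, W, by simpa using hε.le⟩⟩

theorem CylinderApprox.compl {A : Set X} (hA : CylinderApprox μ T f A) :
    CylinderApprox μ T f Aᶜ := by
  refine ⟨hA.1.compl, fun ε hε => ?_⟩
  obtain ⟨l, W, hW⟩ := hA.2 ε hε
  refine ⟨l, Wᶜ, ?_⟩
  rwa [preimage_compl, compl_symmDiff_compl]

variable [IsFiniteMeasure μ]

theorem cylinderApprox_of_forall {A : Set X} (hA : MeasurableSet A)
    (h : ∀ ε > 0, ∃ B, CylinderApprox μ T f B ∧ μ.real (symmDiff A B) ≤ ε) :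
    CylinderApprox μ T f A := by
  refine ⟨hA, fun ε hε => ?_⟩
  obtain ⟨B, hB, hAB⟩ := h (ε / 2) (half_pos hε)
  obtain ⟨l, W, hW⟩ := hB.2 (ε / 2) (half_pos hε)
  exact ⟨l, W, (measureReal_symmDiff_le (t := B) _).trans (by linarith)⟩

theorem CylinderApprox.congr {A B : Set X} (hB : CylinderApprox μ T f B) (hA : MeasurableSet A)
    (h : A =ᵐ[μ] B) : CylinderApprox μ T f A :=
  cylinderApprox_of_forall hA fun ε hε => ⟨B, hB, by
    rw [measureReal_def, measure_symmDiff_eq_zero_iff.2 h]; simpa using hε.le⟩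

theorem CylinderApprox.union {A B : Set X} (hA : CylinderApprox μ T f A)
    (hB : CylinderApprox μ T f B) : CylinderApprox μ T f (A ∪ B) := by
  refine ⟨hA.1.union hB.1, fun ε hε => ?_⟩
  obtain ⟨l, hl⟩ := hA.exists_le (half_pos hε)
  obtain ⟨l', hl'⟩ := hB.exists_le (half_pos hε)
  obtain ⟨W, hW⟩ := hl _ (le_max_left l l')
  obtain ⟨W', hW'⟩ := hl' _ (le_max_right l l')
  refine ⟨_, W ∪ W', (measureReal_mono ?_).trans ((measureReal_union_le _ _).trans
    (add_le_add hW hW' |>.trans (add_halves ε).le))⟩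
  rw [preimage_union]
  intro x hx
  simp only [mem_symmDiff, mem_union] at hx ⊢
  tauto

/-- Continuity from below replaces the countable union by a finite one, up to small measure. -/
theorem CylinderApprox.iUnion {A : ℕ → Set X} (hA : ∀ n, CylinderApprox μ T f (A n)) :
    CylinderApprox μ T f (⋃ n, A n) := by
  have hacc : ∀ n, CylinderApprox μ T f (accumulate A n) := by
    intro n
    induction n with
    | zero => simpa [accumulate_zero_nat] using hA 0
    | succ n ih => rw [accumulate_succ]; exact ih.union (hA _)
  refine cylinderApprox_of_forall (MeasurableSet.iUnion fun n => (hA n).1) fun ε hε => ?_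
  have h := (ENNReal.tendsto_toReal (measure_ne_top μ _)).comp
    (tendsto_measure_iUnion_accumulate (μ := μ) (f := A))
  obtain ⟨n, hn⟩ := (h.eventually_const_lt
    (show (μ (⋃ n, A n)).toReal - ε < _ by linarith)).exists
  refine ⟨accumulate A n, hacc n, ?_⟩
  have hsub : accumulate A n ⊆ ⋃ n, A n := accumulate_subset_iUnion n
  rw [symmDiff_comm, symmDiff_of_le hsub]
  change μ.real ((⋃ n, A n) \ accumulate A n) ≤ ε
  rw [measureReal_sdiff hsub (hacc n).1]
  simp only [Function.comp] at hn
  simp only [measureReal_def]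
  linarith

/-- The σ-algebra of sets approximated by cylinders. -/
@[reducible] def cylinderApproxSpace (μ : Measure X) [IsFiniteMeasure μ] (T : X → X) (f : X → ι) :
    MeasurableSpace X where
  MeasurableSet' := CylinderApprox μ T f
  measurableSet_empty := by simpa using cylinderApprox_preimage (μ := μ) (T := T) (f := f) (l := 0) ∅
  measurableSet_compl _ h := h.compl
  measurableSet_iUnion _ h := CylinderApprox.iUnion h

theorem exists_finset_measureReal_compl_le {κ : Type*} [Countable κ] [MeasurableSpace κ]
    [DiscreteMeasurableSpace κ] {g : X → κ} (hg : Measurable g) {ε : ℝ} (hε : 0 < ε) :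
    ∃ S : Finset κ, μ.real (g ⁻¹' (S : Set κ))ᶜ ≤ ε := by
  obtain ⟨e, he⟩ := exists_injective_nat κ
  obtain ⟨R, hR⟩ := exists_measureReal_lt_of_measurable (μ := μ) (g := fun x => (e (g x) : ℝ))
    ((measurable_of_countable fun a => (e a : ℝ)).comp hg) hε
  have hfin : {a : κ | (e a : ℝ) ≤ R}.Finite := by
    refine ((finite_Iic ⌊R⌋₊).preimage he.injOn).subset fun a ha => ?_
    exact Nat.le_floor ha
  refine ⟨hfin.toFinset, le_of_eq_of_le ?_ hR.le⟩
  congr 1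
  ext x
  simp

/-- A finite-valued function is approximated by functions of finitely many letters. -/
theorem exists_approx_of_cylinderApprox {m : ℕ} [NeZero m] {g : X → Fin m}
    (hg : ∀ i, CylinderApprox μ T f (g ⁻¹' {i})) {ε : ℝ} (hε : 0 < ε) :
    ∃ l : ℕ, ∃ F : (Fin l → ι) → Fin m, μ.real {x | F (itinerary T f l x) ≠ g x} ≤ ε := by
  classical
  have hm : (0 : ℝ) < m := by exact_mod_cast Nat.pos_of_ne_zero (NeZero.ne m)
  choose l₀ hl₀ using fun i => (hg i).exists_le (div_pos hε hm)
  set l := Finset.univ.sup l₀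
  choose W hW using fun i => hl₀ i l (Finset.le_sup (Finset.mem_univ i))
  refine ⟨l, fun w => if h : ∃ i, w ∈ W i then h.choose else 0, ?_⟩
  have hsub : {x | (if h : ∃ i, itinerary T f l x ∈ W i then h.choose else 0) ≠ g x} ⊆
      ⋃ i, symmDiff (g ⁻¹' {i}) (itinerary T f l ⁻¹' W i) := by
    intro x hx
    by_contra hcon
    simp only [mem_iUnion, mem_symmDiff, mem_preimage, mem_singleton_iff, not_exists] at hcon
    apply hx
    have h1 : itinerary T f l x ∈ W (g x) := by
      have := hcon (g x)
      tauto
    have h : ∃ i, itinerary T f l x ∈ W i := ⟨_, h1⟩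
    rw [dif_pos h]
    have h2 := h.choose_spec
    have := hcon h.choose
    tauto
  calc _ ≤ _ := measureReal_mono hsub
    _ ≤ ∑ i, μ.real (symmDiff (g ⁻¹' {i}) (itinerary T f l ⁻¹' W i)) :=
        measureReal_iUnion_fintype_le _
    _ ≤ ∑ i : Fin m, ε / m := Finset.sum_le_sum fun i _ => hW i
    _ = ε := by simp; field_simp

variable [Countable ι] [MeasurableSpace ι] [DiscreteMeasurableSpace ι]

/-- Approximation by finitely many cylinders. -/
theorem CylinderApprox.exists_finset (hT : Measurable T) (hf : Measurable f) {A : Set X}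
    (hA : CylinderApprox μ T f A) {N : Set ι} (hN : ∀ᵐ x ∂μ, ∀ j, f (T^[j] x) ∉ N) {ε : ℝ}
    (hε : 0 < ε) : ∃ l : ℕ, ∃ V : Finset (Fin l → ι), (∀ w ∈ V, ∀ i, w i ∉ N) ∧
      μ.real (symmDiff A (itinerary T f l ⁻¹' V)) ≤ ε := by
  classical
  obtain ⟨l, W, hW⟩ := hA.2 (ε / 2) (half_pos hε)
  obtain ⟨S, hS⟩ := exists_finset_measureReal_compl_le (μ := μ) (measurable_itinerary hT hf l)
    (half_pos hε)
  -- The law of the itinerary lives on a countable set, so finitely many words suffice, and words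
  -- using a label of `N` are almost surely not seen.
  refine ⟨l, S.filter fun w => w ∈ W ∧ ∀ i, w i ∉ N, fun w hw => (Finset.mem_filter.1 hw).2.2, ?_⟩
  have hsub : (symmDiff A (itinerary T f l ⁻¹' (S.filter fun w => w ∈ W ∧ ∀ i, w i ∉ N :
      Finset (Fin l → ι)))) ≤ᵐ[μ]
      (symmDiff A (itinerary T f l ⁻¹' W) ∪
        (itinerary T f l ⁻¹' (S : Set (Fin l → ι)))ᶜ : Set X) := by
    filter_upwards [hN] with x hx hxm
    have hx' : ∀ i, itinerary T f l x i ∉ N := fun i => hx i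
    have hxm' : x ∈ symmDiff A (itinerary T f l ⁻¹' (S.filter fun w => w ∈ W ∧ ∀ i, w i ∉ N :
      Finset (Fin l → ι))) := hxm
    change x ∈ (symmDiff A (itinerary T f l ⁻¹' W) ∪
      (itinerary T f l ⁻¹' (S : Set (Fin l → ι)))ᶜ : Set X)
    simp only [mem_symmDiff, mem_union, mem_preimage, mem_compl_iff, Finset.mem_coe,
      Finset.mem_filter] at hxm' ⊢
    tauto
  refine (ENNReal.toReal_mono (measure_ne_top _ _) (measure_mono_ae hsub)).trans ?_
  refine (measureReal_union_le (μ := μ) (symmDiff A (itinerary T f l ⁻¹' W))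
    (itinerary T f l ⁻¹' (S : Set (Fin l → ι)))ᶜ).trans ?_
  linarith

end Approximation

/-! ### Small cylinders for generating partitions -/

section HammingBall

/-- An exponential Markov inequality: the weights `t ^ hammingDist v w` factor over the coordinates,
each factor being at most `1 + m t ≤ exp (m t)`. The parameter `t` is left free for later tuning. -/
theorem card_hammingBall_le {n m : ℕ} (w : Fin n → Fin m) {t : ℝ} (ht0 : 0 < t) (ht1 : t ≤ 1)
    (ρ : ℝ) : ((Finset.univ.filter fun v : Fin n → Fin m => (hammingDist v w : ℝ) ≤ ρ).card : ℝ) ≤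
      Real.exp (n * (m * t) - ρ * Real.log t) := by
  have hsum : ∑ v : Fin n → Fin m, t ^ hammingDist v w ≤ Real.exp (n * (m * t)) := by
    have h1 : ∀ v : Fin n → Fin m, t ^ hammingDist v w = ∏ j, if v j ≠ w j then t else 1 := by
      intro v
      rw [Finset.prod_ite]
      simp [hammingDist]
    simp only [h1]
    have h2 := Finset.prod_univ_sum (fun _ : Fin n => (Finset.univ : Finset (Fin m)))
      (fun j a => if a ≠ w j then t else (1 : ℝ))
    rw [Fintype.piFinset_univ] at h2
    rw [← h2]
    calc _ ≤ ∏ j : Fin n, Real.exp (m * t) := by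
          refine Finset.prod_le_prod (fun j _ => Finset.sum_nonneg fun a _ => by positivity)
            fun j _ => ?_
          have h3 : ∑ a : Fin m, (if a ≠ w j then t else 1) ≤
              ∑ a : Fin m, (t + if a = w j then 1 else 0) :=
            Finset.sum_le_sum fun a _ => by by_cases h : a = w j <;> simp [h, ht0.le]
          rw [Finset.sum_add_distrib] at h3
          simp only [Finset.sum_const, Finset.card_univ, Fintype.card_fin, nsmul_eq_mul,
            Finset.sum_ite_eq', Finset.mem_univ, if_true] at h3
          exact h3.trans (Real.add_one_le_exp _)
      _ = _ := by simp [← Real.exp_nat_mul]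
  set B := Finset.univ.filter fun v : Fin n → Fin m => (hammingDist v w : ℝ) ≤ ρ
  have h4 : B.card * Real.exp (ρ * Real.log t) ≤ ∑ v : Fin n → Fin m, t ^ hammingDist v w := by
    rw [← nsmul_eq_mul, ← Finset.sum_const]
    refine (Finset.sum_le_sum fun v hv => ?_).trans
      (Finset.sum_le_univ_sum_of_nonneg fun v => by positivity)
    rw [← Real.rpow_natCast, Real.rpow_def_of_pos ht0, mul_comm (Real.log t)]
    refine Real.exp_le_exp.2 (mul_le_mul_of_nonpos_right ?_ (Real.log_nonpos ht0.le ht1))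
    exact (Finset.mem_filter.1 hv).2
  rw [Real.exp_sub, le_div_iff₀ (Real.exp_pos _)]
  exact h4.trans hsum

end HammingBall

/-! ### Transfer of the lower bound to countable generators. -/

section Generator

variable {X : Type*} [MeasurableSpace X] {μ : Measure X} [IsProbabilityMeasure μ] {T : X → X}
  {ι : Type*} {f : X → ι} [Countable ι] [MeasurableSpace ι] [DiscreteMeasurableSpace ι]

/-- Below the entropy, `exp (n b)` cylinders of rank `n` of a generating partition cover little. -/
theorem eventually_measureReal_preimage_finset_le_of_generating (hT : Ergodic T μ)
    (hf : Measurable f) (hgen : ∀ A, MeasurableSet A → CylinderApprox μ T f A) {b : ℝ}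
    (hb : 0 ≤ b) (hlt : ENNReal.ofReal b < ksEntropy μ T) {δ : ℝ} (hδ : 0 < δ) :
    ∀ᶠ n : ℕ in atTop, ∀ S : Finset (Fin n → ι), (S.card : ℝ) ≤ Real.exp (n * b) →
      μ.real (itinerary T f n ⁻¹' S) ≤ δ := by
  classical
  have hmp := hT.toMeasurePreserving
  simp only [ksEntropy, lt_iSup_iff] at hlt
  obtain ⟨m, g, hg, hlt⟩ := hlt
  have hm0 : NeZero m := by
    have : Nonempty X := nonempty_of_isProbabilityMeasure μ
    exact ⟨fun h => by subst h; exact (g (Classical.arbitrary X)).elim0⟩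
  obtain ⟨r, hr0, hr1, hr2⟩ := ENNReal.lt_iff_exists_real_btwn.1 hlt
  have hbr : b < r := (ENNReal.ofReal_lt_ofReal_iff_of_nonneg hb).1 hr1
  have hm : (0 : ℝ) < m := by exact_mod_cast Nat.pos_of_ne_zero (NeZero.ne m)
  -- One third of the gap goes to each of the two exponents of the Hamming ball bound, `m * t` and
  -- `-η * log t`, and one third to the `l` extra letters; `t` and `η` are tuned accordingly.
  set c := (r - b) / 3 with hc
  have hc0 : 0 < c := by simp only [hc]; linarith
  set t := min (1 / 2) (c / m) with ht
  have ht0 : 0 < t := lt_min (by norm_num) (by positivity)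
  have ht1 : t ≤ 1 := (min_le_left _ _).trans (by norm_num)
  have htm : m * t ≤ c := by
    have := min_le_right (1 / 2) (c / m)
    rw [le_div_iff₀ hm] at this
    linarith
  have hlog : Real.log t < 0 := Real.log_neg ht0 ((min_le_left _ _).trans_lt (by norm_num))
  set η := c / (-Real.log t) with hη
  have hη0 : 0 < η := div_pos hc0 (by linarith)
  have hηlog : -(η * Real.log t) = c := by
    have := hlog.ne
    simp only [hη]; field_simp
  obtain ⟨l, F, hF⟩ := exists_approx_of_cylinderApprox
    (fun i => hgen _ (hg (measurableSet_singleton i))) (show 0 < η * (δ / 2) by positivity)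
  set D : Set X := {x | F (itinerary T f l x) ≠ g x} with hD
  have hDm : MeasurableSet D := by
    refine (measurableSet_eq_fun ?_ hg).compl
    exact (measurable_of_countable F).comp (measurable_itinerary hmp.measurable hf l)
  have hev : ∀ᶠ n : ℕ in atTop, ∀ S : Finset (Fin (n + l) → ι),
      (S.card : ℝ) ≤ Real.exp ((n + l : ℕ) * b) → μ.real (itinerary T f (n + l) ⁻¹' S) ≤ δ := by
    filter_upwards [eventually_measureReal_preimage_finset_le hT hg hr0 hr2 (half_pos hδ),
      (tendsto_natCast_atTop_atTop (R := ℝ)).eventually_ge_atTop (l * b / c),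
      eventually_gt_atTop 0] with n hn hnl hn0 S hS
    have hn0' : (0 : ℝ) < n := by exact_mod_cast hn0
    let Θ : (Fin (n + l) → ι) → Fin n → Fin m :=
      fun w j => F fun i => w ⟨j + i, by omega⟩
    have hΘ : ∀ x (j : Fin n), Θ (itinerary T f (n + l) x) j = F (itinerary T f l (T^[j] x)) := by
      intro x j
      simp only [Θ]
      congr 1
      funext i
      simp only [itinerary]
      rw [add_comm, Function.iterate_add_apply]
    -- The block code `Θ` predicts the `g`-name from the `f`-name. For most points it errs in at
    -- most `η n` places, so the true name lies in a Hamming ball around the prediction.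
    set S' : Finset (Fin n → Fin m) := S.biUnion fun w =>
      Finset.univ.filter fun v => (hammingDist v (Θ w) : ℝ) ≤ η * n
    have hS' : (S'.card : ℝ) ≤ Real.exp (n * r) := by
      calc (S'.card : ℝ) ≤ ∑ w ∈ S, ((Finset.univ.filter fun v : Fin n → Fin m =>
            (hammingDist v (Θ w) : ℝ) ≤ η * n).card : ℝ) := by
            exact_mod_cast Finset.card_biUnion_le
        _ ≤ ∑ w ∈ S, Real.exp (n * (m * t) - η * n * Real.log t) :=
            Finset.sum_le_sum fun w _ => card_hammingBall_le _ ht0 ht1 _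
        _ = S.card * Real.exp (n * (m * t) - η * n * Real.log t) := by simp
        _ ≤ Real.exp ((n + l : ℕ) * b) * Real.exp (n * (m * t) - η * n * Real.log t) := by gcongr
        _ ≤ Real.exp (n * r) := by
            rw [← Real.exp_add]
            refine Real.exp_le_exp.2 ?_
            have h1 : η * n * Real.log t = -(n * c) := by rw [← hηlog]; ring
            have h2 : l * b ≤ n * c := by rwa [div_le_iff₀ hc0] at hnl
            have h3 := mul_le_mul_of_nonneg_left htm hn0'.le
            have h4 : (n : ℝ) * r = n * b + n * c + n * c + n * c := by simp only [hc]; ring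
            push_cast
            rw [h1, h4]
            linarith
    have hS'm := hn S' hS'
    set ind : X → ℝ := D.indicator fun _ => 1
    have hindi : Integrable ind μ := (integrable_const 1).indicator hDm
    have hbad : μ.real {x | η ≤ |birkhoffAverage ℝ T ind n x|} ≤ δ / 2 := by
      have h1 := mul_measureReal_ge_abs_le_integral_abs (integrable_birkhoffAverage hmp hindi n) η
      have h2 := integral_abs_birkhoffAverage_le hmp hindi n
      have h3 : ∫ x, |ind x| ∂μ = μ.real D := by
        have : ∀ x, |ind x| = ind x := fun x =>
          abs_of_nonneg (indicator_nonneg (fun _ _ => zero_le_one) x)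
        simp only [this, ind]
        simp [integral_indicator hDm]
      have h4 : η * μ.real {x | η ≤ |birkhoffAverage ℝ T ind n x|} ≤ η * (δ / 2) := by linarith
      exact le_of_mul_le_mul_left h4 hη0
    have hsub : itinerary T f (n + l) ⁻¹' S ⊆
        itinerary T g n ⁻¹' S' ∪ {x | η ≤ |birkhoffAverage ℝ T ind n x|} := by
      intro x hx
      by_cases hxb : η ≤ |birkhoffAverage ℝ T ind n x|
      · exact Or.inr hxb
      refine Or.inl (Finset.mem_coe.2 (Finset.mem_biUnion.2 ⟨_, hx, ?_⟩))
      simp only [Finset.mem_filter, Finset.mem_univ, true_and]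
      -- The coding errors of `x` are exactly the visits of its orbit to `D` before time `n`.
      have hdist : (hammingDist (itinerary T g n x) (Θ (itinerary T f (n + l) x)) : ℝ)
          = n * birkhoffAverage ℝ T ind n x := by
        simp only [hammingDist, birkhoffAverage, birkhoffSum, smul_eq_mul]
        rw [mul_inv_cancel_left₀ hn0'.ne', Finset.card_filter, Nat.cast_sum,
          Finset.sum_range]
        refine Finset.sum_congr rfl fun j _ => ?_
        simp only [ind, indicator_apply, hD, mem_ofPred_eq, hΘ]
        have e : itinerary T g n x j = g (T^[j] x) := rfl
        by_cases h : F (itinerary T f l (T^[j] x)) = g (T^[j] x)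
        · simp [h, e]
        · simp [h, e, Ne.symm h]
      rw [hdist, mul_comm η]
      exact mul_le_mul_of_nonneg_left ((le_abs_self _).trans (not_le.1 hxb).le) hn0'.le
    linarith [(measureReal_mono (μ := μ) hsub).trans (measureReal_union_le _ _)]
  obtain ⟨n0, hn0⟩ := eventually_atTop.1 hev
  refine eventually_atTop.2 ⟨n0 + l, fun N hN => ?_⟩
  obtain ⟨n, rfl⟩ : ∃ n, N = n + l := ⟨N - l, by omega⟩
  exact hn0 n (by omega)

end Generator

/-! ### Interval partitions -/

section IntervalPartition

theorem isOpen_realInterior (J : Set I) : IsOpen (realInterior J) :=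
  isOpen_interior.preimage continuous_subtype_val

theorem realInterior_subset (J : Set I) : realInterior J ⊆ J := by
  intro x hx
  obtain ⟨y, hy, hyx⟩ := interior_subset (show (x : ℝ) ∈ interior (Subtype.val '' J) from hx)
  exact Subtype.ext hyx ▸ hy

theorem ordConnected_image_val {J : Set I} (hJ : J.OrdConnected) :
    (Subtype.val '' J : Set ℝ).OrdConnected := by
  refine ⟨?_⟩
  rintro _ ⟨x, hx, rfl⟩ _ ⟨y, hy, rfl⟩ z hz
  exact ⟨⟨z, x.2.1.trans hz.1, hz.2.trans y.2.2⟩, hJ.out hx hy ⟨hz.1, hz.2⟩, rfl⟩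

theorem ordConnected_realInterior {J : Set I} (hJ : J.OrdConnected) :
    (realInterior J).OrdConnected :=
  (ordConnected_image_val hJ).interior.preimage_mono (Subtype.mono_coe _)

/-- The difference lies in the frontier of a convex set, which is null. -/
theorem volume_diff_realInterior {J : Set I} (hJ : J.OrdConnected) :
    volume (J \ realInterior J) = 0 := by
  rw [Measure.Subtype.volume_def, comap_subtype_coe_apply measurableSet_Icc]
  have h := ((ordConnected_image_val hJ).convex).addHaar_frontier volume
  refine measure_mono_null ?_ h
  rintro _ ⟨x, ⟨hx, hxi⟩, rfl⟩
  exact ⟨subset_closure ⟨x, hx, rfl⟩, hxi⟩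

/-- The labels of the cells of a partition, together with a label for the points outside the
interiors of the cells. -/
inductive CellLabel (𝒜 : Set (Set I)) : Type
  | cell (J : 𝒜) : CellLabel 𝒜
  | outside : CellLabel 𝒜

instance (𝒜 : Set (Set I)) : MeasurableSpace (CellLabel 𝒜) := ⊤

instance (𝒜 : Set (Set I)) : DiscreteMeasurableSpace (CellLabel 𝒜) := ⟨fun _ => trivial⟩

instance (𝒜 : Set (Set I)) [Countable 𝒜] : Countable (CellLabel 𝒜) :=
  Function.Surjective.countable (f := fun o : Option 𝒜 => o.elim CellLabel.outside CellLabel.cell)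
    fun a => match a with
      | .cell J => ⟨some J, rfl⟩
      | .outside => ⟨none, rfl⟩

theorem CellLabel.cell_injective {𝒜 : Set (Set I)} :
    Function.Injective (CellLabel.cell (𝒜 := 𝒜)) := fun _ _ h => CellLabel.cell.inj h

/-- The label of the cell whose interior contains `x`. -/
def cellLabel (𝒜 : Set (Set I)) (x : I) : CellLabel 𝒜 :=
  open Classical in if h : ∃ J : 𝒜, x ∈ realInterior J then .cell h.choose else .outside

variable {𝒜 : Set (Set I)}

theorem cellLabel_eq_some_iff (hP : IsIntervalPartition 𝒜) {x : I} {J : 𝒜} :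
    cellLabel 𝒜 x = .cell J ↔ x ∈ realInterior J := by
  classical
  unfold cellLabel
  constructor
  · intro h
    split_ifs at h with hx
    rw [← CellLabel.cell.inj h]
    exact hx.choose_spec
  · intro h
    have hx : ∃ J : 𝒜, x ∈ realInterior J := ⟨J, h⟩
    rw [dif_pos hx]
    congr 1
    by_contra hne
    exact disjoint_left.1 (hP.disjoint_interior hx.choose.2 J.2 fun e => hne (Subtype.ext e))
      hx.choose_spec h

theorem measurable_cellLabel (hP : IsIntervalPartition 𝒜) : Measurable (cellLabel 𝒜) := by
  have : Countable 𝒜 := hP.countable.to_subtype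
  have hs : ∀ J : 𝒜, MeasurableSet (cellLabel 𝒜 ⁻¹' {.cell J}) := by
    intro J
    have : cellLabel 𝒜 ⁻¹' {.cell J} = realInterior J := by
      ext x
      exact cellLabel_eq_some_iff hP
    rw [this]
    exact (isOpen_realInterior _).measurableSet
  refine measurable_to_countable' fun y => ?_
  match y with
  | .cell J => exact hs J
  | .outside =>
    have : cellLabel 𝒜 ⁻¹' {.outside}
        = (⋃ J : 𝒜, cellLabel 𝒜 ⁻¹' {.cell J})ᶜ := by
      ext x
      simp only [mem_preimage, mem_singleton_iff, mem_compl_iff, mem_iUnion, not_exists]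
      cases cellLabel 𝒜 x <;> simp
    rw [this]
    exact (MeasurableSet.iUnion hs).compl

theorem ae_mem_iff_cellLabel_eq (hP : IsIntervalPartition 𝒜) :
    ∀ᵐ x : I, ∀ J : 𝒜, x ∈ (J : Set I) ↔ cellLabel 𝒜 x = .cell J := by
  have : Countable 𝒜 := hP.countable.to_subtype
  refine ae_all_iff.2 fun J => ?_
  have h := measure_eq_zero_iff_ae_notMem.1 (volume_diff_realInterior (hP.interval J J.2))
  filter_upwards [h] with x hx
  rw [cellLabel_eq_some_iff hP]
  exact ⟨fun h => by_contra fun h' => hx ⟨h, h'⟩, fun h => realInterior_subset _ h⟩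

theorem ae_cellLabel_ne_none (hP : IsIntervalPartition 𝒜) :
    ∀ᵐ x : I, cellLabel 𝒜 x ≠ .outside := by
  have h := measure_eq_zero_iff_ae_notMem.1 hP.cover
  filter_upwards [h, ae_mem_iff_cellLabel_eq hP] with x hx hx2 hn
  obtain ⟨J, hJ, hxJ⟩ := not_not.1 hx
  have := (hx2 ⟨J, hJ⟩).1 hxJ
  rw [hn] at this
  cases this

end IntervalPartition

/-! ### Consequences of membership in `𝒯`. -/

section ClassT

variable {T : I → I} {μ : Measure I} {𝒜 : Set (Set I)}

theorem MemClassT.absolutelyContinuous (h : MemClassT T μ 𝒜) : μ ≪ volume := by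
  have := h.isProbabilityMeasure
  obtain ⟨c, hc, hcA⟩ := h.comparable
  refine Measure.AbsolutelyContinuous.mk fun A hA h0 => ?_
  have h1 := (hcA A hA).1
  rw [measureReal_def volume, h0, ENNReal.toReal_zero] at h1
  have h2 : μ.real A = 0 := by
    have hc0 : 0 < c⁻¹ := by positivity
    have := measureReal_nonneg (μ := μ) (s := A)
    nlinarith
  exact (measureReal_eq_zero_iff).1 h2

theorem MemClassT.absolutelyContinuous' (h : MemClassT T μ 𝒜) : volume ≪ μ := by
  have := h.isProbabilityMeasure
  obtain ⟨c, hc, hcA⟩ := h.comparable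
  refine Measure.AbsolutelyContinuous.mk fun A hA h0 => ?_
  have h1 := (hcA A hA).2
  rw [measureReal_def μ, h0, ENNReal.toReal_zero, mul_zero] at h1
  exact (measureReal_eq_zero_iff).1 (le_antisymm h1 measureReal_nonneg)

theorem MemClassT.countable (h : MemClassT T μ 𝒜) : Countable 𝒜 :=
  h.partition.countable.to_subtype

theorem MemClassT.ae_iterate (h : MemClassT T μ 𝒜) {p : I → Prop} (hp : ∀ᵐ x : I, p x) :
    ∀ᵐ x ∂μ, ∀ j, p (T^[j] x) :=
  ae_all_iff.2 fun j => (h.ergodic.toMeasurePreserving.iterate j).quasiMeasurePreserving.ae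
    (h.absolutelyContinuous.ae_le hp)

/-- The approximable sets form a σ-algebra containing the preimages of the cells, which agree almost
everywhere with the preimages of their interiors. Generation modulo null sets gives the rest. -/
theorem MemClassT.cylinderApprox (h : MemClassT T μ 𝒜) {A : Set I} (hA : MeasurableSet A) :
    CylinderApprox μ T (cellLabel 𝒜) A := by
  have := h.isProbabilityMeasure
  have hT := h.ergodic.measurable
  have hl := measurable_cellLabel h.partition
  have hle : fullCylinderAlgebra T 𝒜 ≤ cylinderApproxSpace μ T (cellLabel 𝒜) := by
    refine iSup_le fun j => ?_
    rw [MeasurableSpace.comap_generateFrom]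
    refine MeasurableSpace.generateFrom_le ?_
    rintro _ ⟨J, hJ, rfl⟩
    change CylinderApprox μ T (cellLabel 𝒜) (T^[j] ⁻¹' J)
    have hm : MeasurableSet (itinerary T (cellLabel 𝒜) (j + 1) ⁻¹'
        {w | w (Fin.last j) = .cell ⟨J, hJ⟩}) := by
      have := (hl.comp (hT.iterate j)) (measurableSet_singleton (CellLabel.cell ⟨J, hJ⟩))
      exact this
    refine (cylinderApprox_preimage _ hm).congr
      ((hT.iterate j) (h.partition.interval J hJ).measurableSet) ?_
    filter_upwards [h.ae_iterate (ae_mem_iff_cellLabel_eq h.partition)] with x hx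
    exact propext (hx j ⟨J, hJ⟩)
  obtain ⟨B, hB, hAB⟩ := h.generates A hA
  exact CylinderApprox.congr (hle B hB) hA (h.absolutelyContinuous.ae_eq hAB)

/-- Passing from cells to interiors changes no measure, and the label `outside` carries none. -/
theorem MemClassT.summable_negMulLog (h : MemClassT T μ 𝒜) :
    Summable fun a : CellLabel 𝒜 => Real.negMulLog (μ.real (cellLabel 𝒜 ⁻¹' {a})) := by
  have hs : ∀ J : 𝒜, μ.real (J : Set I) = μ.real (cellLabel 𝒜 ⁻¹' {.cell J}) := by
    intro J
    refine measureReal_congr ?_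
    filter_upwards [h.absolutelyContinuous.ae_le (ae_mem_iff_cellLabel_eq h.partition)] with x hx
    exact propext (hx J)
  have hn : μ.real (cellLabel 𝒜 ⁻¹' {.outside}) = 0 := by
    rw [measureReal_def, measure_eq_zero_iff_ae_notMem.2, ENNReal.toReal_zero]
    filter_upwards [h.absolutelyContinuous.ae_le (ae_cellLabel_ne_none h.partition)] with x hx
    exact hx
  have h1 := h.finite_entropy
  simp only [hs] at h1
  refine (CellLabel.cell_injective.summable_iff (f := fun a : CellLabel 𝒜 =>
    Real.negMulLog (μ.real (cellLabel 𝒜 ⁻¹' {a}))) ?_).1 h1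
  intro a ha
  match a with
  | .cell J => exact absurd (mem_range_self J) ha
  | .outside => simp only [hn, Real.negMulLog_zero]

/-- A cylinder avoiding the exceptional label is an interval. -/
theorem MemClassT.ordConnected_cylinder (h : MemClassT T μ 𝒜) : ∀ {n : ℕ}
    (w : Fin n → CellLabel 𝒜), (∀ i, w i ≠ .outside) →
    (itinerary T (cellLabel 𝒜) n ⁻¹' {w}).OrdConnected := by
  intro n
  induction n with
  | zero =>
    intro w _
    have : itinerary T (cellLabel 𝒜) 0 ⁻¹' {w} = univ :=
      eq_univ_of_forall fun y => Subsingleton.elim _ _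
    rw [this]
    exact ordConnected_univ
  | succ n ih =>
    intro w hw
    have ih' := ih (Fin.tail w) fun i => hw i.succ
    obtain ⟨J, hJ⟩ : ∃ J, w 0 = .cell J := by
      cases hw0 : w 0 with
      | cell J => exact ⟨J, rfl⟩
      | outside => exact absurd hw0 (hw 0)
    have h0 : cellLabel 𝒜 ⁻¹' {w 0} = realInterior J := by
      rw [hJ]
      ext x
      exact cellLabel_eq_some_iff h.partition
    rw [preimage_itinerary_succ, h0]
    refine ⟨fun x hx y hy z hz => ?_⟩
    have hzJ := (ordConnected_realInterior (h.partition.interval J J.2)).out hx.1 hy.1 hz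
    refine ⟨hzJ, ?_⟩
    -- A monotone branch pulls the interval of the tail back to an interval, in either orientation.
    rcases h.strictMonotone J J.2 with hm | hm
    · exact ih'.out hx.2 hy.2 ⟨hm.monotoneOn hx.1 hzJ hz.1, hm.monotoneOn hzJ hy.1 hz.2⟩
    · exact ih'.out hy.2 hx.2 ⟨hm.antitoneOn hzJ hy.1 hz.2, hm.antitoneOn hx.1 hzJ hz.1⟩

end ClassT

/-! ### Sequences of sets of low complexity -/

section LowComplexity

/-- Every interval that avoids `E` is contained in `G` or disjoint from it. -/
def Separates (E : Finset I) (G : Set I) : Prop :=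
  ∀ C : Set I, C.OrdConnected → (∀ e ∈ E, e ∉ C) → C ⊆ G ∨ Disjoint C G

theorem Separates.inter {E E' : Finset I} {G G' : Set I} (h : Separates E G)
    (h' : Separates E' G') : Separates (E ∪ E') (G ∩ G') := by
  intro C hC hE
  have h1 := h C hC fun e he => hE e (Finset.mem_union_left _ he)
  have h2 := h' C hC fun e he => hE e (Finset.mem_union_right _ he)
  rcases h1 with h1 | h1
  · rcases h2 with h2 | h2
    · exact Or.inl (subset_inter h1 h2)
    · exact Or.inr (h2.mono_right inter_subset_right)
  · exact Or.inr (h1.mono_right inter_subset_left)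

theorem separates_univ : Separates ∅ univ := fun _ _ _ => Or.inl (subset_univ _)

theorem separates_biUnion {κ : Type*} [DecidableEq κ] (V : Finset κ) {E : κ → Finset I}
    {G : κ → Set I} (h : ∀ w ∈ V, Separates (E w) (G w)) :
    Separates (V.biUnion E) (⋃ w ∈ V, G w) := by
  intro C hC hE
  by_cases hex : ∃ w ∈ V, C ⊆ G w
  · obtain ⟨w, hw, hCw⟩ := hex
    exact Or.inl (hCw.trans (subset_biUnion_of_mem (u := G) hw))
  · refine Or.inr (disjoint_iUnion₂_right.2 fun w hw => ?_)
    rcases h w hw C hC fun e he => hE e (Finset.mem_biUnion.2 ⟨w, hw, he⟩) with h1 | h1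
    · exact absurd ⟨w, hw, h1⟩ hex
    · exact h1

/-- An interval meeting both `J` and its complement must contain an endpoint of `J`. -/
theorem separates_ordConnected {J : Set I} (hJ : J.OrdConnected) :
    Separates {sInf J, sSup J} J := by
  intro C hC hE
  have hinf : sInf J ∉ C := hE _ (by simp)
  have hsup : sSup J ∉ C := hE _ (by simp)
  by_contra! hcon
  obtain ⟨h1, h2⟩ := hcon
  obtain ⟨y, hyC, hyJ⟩ := not_subset.1 h1
  obtain ⟨x, hxC, hxJ⟩ := not_disjoint_iff.1 h2
  rcases le_total x y with hxy | hxy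
  · refine hsup (hC.out hxC hyC ⟨le_sSup hxJ, sSup_le fun z hz => ?_⟩)
    by_contra hzy
    exact hyJ (hJ.out hxJ hz ⟨hxy, (not_le.1 hzy).le⟩)
  · refine hinf (hC.out hyC hxC ⟨le_sInf fun z hz => ?_, sInf_le hxJ⟩)
    by_contra hzy
    exact hyJ (hJ.out hz hxJ ⟨(not_le.1 hzy).le, hxy⟩)

/-- The sets `G n` are approximated by sets whose boundary has at most `C exp (n a)` points. -/
def LowComplexity (a : ℝ) (G : ℕ → Set I) : Prop :=
  ∀ δ > 0, ∃ C : ℝ, ∀ᶠ n : ℕ in atTop, ∃ (E : Finset I) (G' : Set I), MeasurableSet G' ∧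
    (E.card : ℝ) ≤ C * Real.exp (n * a) ∧ volume.real (symmDiff (G n) G') ≤ δ ∧ Separates E G'

theorem LowComplexity.inter {a : ℝ} {G H : ℕ → Set I} (hG : LowComplexity a G)
    (hH : LowComplexity a H) : LowComplexity a fun n => G n ∩ H n := by
  classical
  intro δ hδ
  obtain ⟨C, hC⟩ := hG (δ / 2) (half_pos hδ)
  obtain ⟨D, hD⟩ := hH (δ / 2) (half_pos hδ)
  refine ⟨C + D, ?_⟩
  filter_upwards [hC, hD] with n ⟨E, G', h1, h2, h3, h4⟩ ⟨F, H', k1, k2, k3, k4⟩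
  refine ⟨E ∪ F, G' ∩ H', h1.inter k1, ?_, ?_, h4.inter k4⟩
  · have : ((E ∪ F).card : ℝ) ≤ E.card + F.card := by exact_mod_cast Finset.card_union_le _ _
    rw [add_mul]
    linarith
  · refine (measureReal_mono (s₂ := symmDiff (G n) G' ∪ symmDiff (H n) H') ?_).trans
      ((measureReal_union_le _ _).trans (by linarith))
    intro x hx
    simp only [mem_symmDiff, mem_union, mem_inter_iff] at hx ⊢
    tauto

theorem lowComplexity_univ (a : ℝ) : LowComplexity a fun _ => univ := fun δ hδ =>
  ⟨0, Eventually.of_forall fun n => ⟨∅, univ, MeasurableSet.univ, by simp, by simpa using hδ.le,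
    separates_univ⟩⟩

theorem lowComplexity_iInter {a : ℝ} {κ : Type*} [Finite κ] {G : κ → ℕ → Set I}
    (h : ∀ i, LowComplexity a (G i)) : LowComplexity a fun n => ⋂ i, G i n := by
  classical
  have := Fintype.ofFinite κ
  have key : ∀ s : Finset κ, LowComplexity a fun n => ⋂ i ∈ s, G i n := by
    intro s
    induction s using Finset.induction_on with
    | empty => simpa using lowComplexity_univ a
    | insert i s _ ih =>
      simp only [Finset.set_biInter_insert]
      exact (h i).inter ih
  simpa using key Finset.univ

variable {T : I → I} {μ : Measure I} {𝒜 : Set (Set I)}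

theorem MemClassT.exists_separates_preimage (h : MemClassT T μ 𝒜) {N : ℕ}
    (V : Finset (Fin N → CellLabel 𝒜)) (hV : ∀ w ∈ V, ∀ i, w i ≠ .outside) :
    ∃ E : Finset I, (E.card : ℝ) ≤ 2 * V.card ∧
      Separates E (itinerary T (cellLabel 𝒜) N ⁻¹' V) := by
  classical
  let C : (Fin N → CellLabel 𝒜) → Set I := fun w => itinerary T (cellLabel 𝒜) N ⁻¹' {w}
  have e : itinerary T (cellLabel 𝒜) N ⁻¹' V = ⋃ w ∈ V, C w := by
    ext x
    simp [C]
  refine ⟨V.biUnion fun w => {sInf (C w), sSup (C w)}, ?_, e ▸ separates_biUnion V fun w hw =>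
    separates_ordConnected (h.ordConnected_cylinder w (hV w hw))⟩
  have := Finset.card_biUnion_le_card_mul V (fun w => ({sInf (C w), sSup (C w)} : Finset I)) 2
    fun w _ => Finset.card_le_two
  rw [mul_comm]
  exact_mod_cast this

theorem MemClassT.exists_volume_le (h : MemClassT T μ 𝒜) {δ : ℝ} (hδ : 0 < δ) :
    ∃ η > 0, ∀ A, MeasurableSet A → μ.real A ≤ η → volume.real A ≤ δ := by
  obtain ⟨c, hc, hcA⟩ := h.comparable
  have hc0 : 0 < c := by linarith
  refine ⟨δ / c, by positivity, fun A hA hμ => (hcA A hA).2.trans ?_⟩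
  rwa [le_div_iff₀ hc0, mul_comm] at hμ

theorem MemClassT.exists_measureReal_le (h : MemClassT T μ 𝒜) {δ : ℝ} (hδ : 0 < δ) :
    ∃ η > 0, ∀ A, MeasurableSet A → volume.real A ≤ η → μ.real A ≤ δ := by
  obtain ⟨c, hc, hcA⟩ := h.comparable
  have hc0 : 0 < c := by linarith
  refine ⟨δ / c, by positivity, fun A hA hμ => ?_⟩
  have := (hcA A hA).1.trans hμ
  rw [inv_mul_le_iff₀ hc0] at this
  rwa [mul_div_cancel₀ _ hc0.ne'] at this

/-- One finite union of cylinders approximates `B` for all `n`; as `0 ≤ a`, its fixed number of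
endpoints is within the allowance. -/
theorem MemClassT.lowComplexity_const (h : MemClassT T μ 𝒜) {a : ℝ} (ha : 0 ≤ a) {B : Set I}
    (hB : MeasurableSet B) : LowComplexity a fun _ => B := by
  have := h.isProbabilityMeasure
  have := h.countable
  have hl := measurable_cellLabel h.partition
  intro δ hδ
  obtain ⟨η, hη, hηA⟩ := h.exists_volume_le hδ
  obtain ⟨l, V, hV, hVm⟩ := (h.cylinderApprox hB).exists_finset h.ergodic.measurable hl
    (N := {.outside}) (h.ae_iterate (ae_cellLabel_ne_none h.partition)) hη
  obtain ⟨E, hE, hsep⟩ := h.exists_separates_preimage V hV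
  have hm := measurableSet_preimage_discrete (measurable_itinerary h.ergodic.measurable hl l) V
  refine ⟨2 * V.card, Eventually.of_forall fun n => ⟨E, _, hm, hE.trans ?_,
    hηA _ (hB.symmDiff hm) hVm, hsep⟩⟩
  exact le_mul_of_one_le_right (by positivity) (Real.one_le_exp (by positivity))

/-- As `A` nearly depends on `l` letters only, `T^{-n} A` nearly depends on the word of length `n +
l`. Keeping the `exp ((n + l) a)` words that cover most of the space leaves at most that many
intervals, with two endpoints each. -/
theorem MemClassT.lowComplexity_preimage (h : MemClassT T μ 𝒜) {a : ℝ}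
    (ha : ksEntropy μ T < ENNReal.ofReal a) {A : Set I} (hA : MeasurableSet A) :
    LowComplexity a fun n => T^[n] ⁻¹' A := by
  classical
  have := h.isProbabilityMeasure
  have := h.countable
  have hl := measurable_cellLabel h.partition
  have hT := h.ergodic.measurable
  have hmp := h.ergodic.toMeasurePreserving
  intro δ hδ
  obtain ⟨η, hη, hηA⟩ := h.exists_volume_le hδ
  obtain ⟨l, W, hW⟩ := (h.cylinderApprox hA).2 (η / 2) (half_pos hη)
  have hcov := eventually_exists_finset_cover h.ergodic hl h.summable_negMulLog ha (half_pos hη)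
  refine ⟨2 * Real.exp (l * a), ?_⟩
  filter_upwards [(tendsto_add_atTop_nat l).eventually hcov] with n ⟨S, hS, hSm⟩
  let sh : (Fin (n + l) → CellLabel 𝒜) → Fin l → CellLabel 𝒜 :=
    fun w i => w ⟨n + i, by omega⟩
  have hsh : ∀ x, sh (itinerary T (cellLabel 𝒜) (n + l) x)
      = itinerary T (cellLabel 𝒜) l (T^[n] x) := by
    intro x
    funext i
    simp only [sh, itinerary]
    rw [add_comm, Function.iterate_add_apply]
  set V := S.filter fun w => (∀ i, w i ≠ .outside) ∧ sh w ∈ W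
  obtain ⟨E, hE, hsep⟩ := h.exists_separates_preimage V fun w hw => (Finset.mem_filter.1 hw).2.1
  have hm := measurableSet_preimage_discrete (measurable_itinerary hT hl (n + l)) V
  refine ⟨E, _, hm, ?_, hηA _ (((hT.iterate n) hA).symmDiff hm) ?_, hsep⟩
  · have h1 : (V.card : ℝ) ≤ S.card := by exact_mod_cast Finset.card_filter_le _ _
    have h2 : Real.exp ((n + l : ℕ) * a) = Real.exp (l * a) * Real.exp (n * a) := by
      rw [← Real.exp_add]
      push_cast
      ring_nf
    rw [h2] at hS
    nlinarith
  · set D := symmDiff A (itinerary T (cellLabel 𝒜) l ⁻¹' W) with hD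
    have hDm : MeasurableSet D :=
      hA.symmDiff (measurableSet_preimage_discrete (measurable_itinerary hT hl l) W)
    have hsub : symmDiff (T^[n] ⁻¹' A) (itinerary T (cellLabel 𝒜) (n + l) ⁻¹' V) ≤ᵐ[μ]
        (T^[n] ⁻¹' D ∪ (itinerary T (cellLabel 𝒜) (n + l) ⁻¹'
          (S : Set (Fin (n + l) → CellLabel 𝒜)))ᶜ : Set I) := by
      filter_upwards [h.ae_iterate (ae_cellLabel_ne_none h.partition)] with x hx hxm
      have hx' : ∀ i, itinerary T (cellLabel 𝒜) (n + l) x i ≠ .outside := fun i => hx i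
      have hxm' : x ∈ symmDiff (T^[n] ⁻¹' A) (itinerary T (cellLabel 𝒜) (n + l) ⁻¹' V) := hxm
      change x ∈ T^[n] ⁻¹' D ∪ (itinerary T (cellLabel 𝒜) (n + l) ⁻¹'
          (S : Set (Fin (n + l) → CellLabel 𝒜)))ᶜ
      simp only [V, hD, mem_symmDiff, mem_union, mem_preimage, mem_compl_iff, Finset.mem_coe,
        Finset.mem_filter, hsh] at hxm' ⊢
      tauto
    refine (ENNReal.toReal_mono (measure_ne_top _ _) (measure_mono_ae hsub)).trans ?_
    refine (measureReal_union_le (μ := μ) (T^[n] ⁻¹' D) _).trans ?_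
    rw [(hmp.iterate n).measureReal_preimage hDm.nullMeasurableSet]
    linarith

end LowComplexity

/-! ### One step: adding an `α`-mixing map of larger entropy -/

section AlphaMixing

variable {T : I → I} {μ : Measure I} {𝒜 : Set (Set I)}

/-- A union of cylinders agrees almost everywhere with a set of the cylinder σ-algebra. -/
theorem MemClassT.exists_cylinderAlgebra_ae_eq (h : MemClassT T μ 𝒜) {m : ℕ}
    {W : Set (Fin m → CellLabel 𝒜)} (hW : ∀ w ∈ W, ∀ i, w i ≠ .outside) :
    ∃ D, MeasurableSet[cylinderAlgebra T 𝒜 m] D ∧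
      D =ᵐ[μ] (itinerary T (cellLabel 𝒜) m ⁻¹' W : Set I) := by
  have := h.countable
  refine ⟨⋃ (w : Fin m → 𝒜) (_ : (fun i => CellLabel.cell (w i)) ∈ W),
    ⋂ j : Fin m, T^[j] ⁻¹' (w j : Set I), ?_, ?_⟩
  · refine MeasurableSet.iUnion fun w => MeasurableSet.iUnion fun _ => MeasurableSet.iInter fun j => ?_
    have hle : (MeasurableSpace.generateFrom 𝒜).comap (T^[(j : ℕ)]) ≤ cylinderAlgebra T 𝒜 m :=
      le_iSup (fun j : Fin m => (MeasurableSpace.generateFrom 𝒜).comap (T^[(j : ℕ)])) j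
    exact hle _ ⟨_, MeasurableSpace.measurableSet_generateFrom (w j).2, rfl⟩
  · filter_upwards [h.ae_iterate (ae_mem_iff_cellLabel_eq h.partition)] with x hx
    refine propext ?_
    change x ∈ (⋃ (w : Fin m → 𝒜) (_ : (fun i => CellLabel.cell (w i)) ∈ W),
      ⋂ j : Fin m, T^[j] ⁻¹' (w j : Set I)) ↔ itinerary T (cellLabel 𝒜) m x ∈ W
    simp only [mem_iUnion, mem_iInter, mem_preimage, hx]
    constructor
    · rintro ⟨w, hw, hxw⟩
      have : itinerary T (cellLabel 𝒜) m x = fun i => CellLabel.cell (w i) := funext hxw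
      rwa [this]
    · intro hxW
      have hcell : ∀ i, ∃ J, itinerary T (cellLabel 𝒜) m x i = .cell J := by
        intro i
        cases hi : itinerary T (cellLabel 𝒜) m x i with
        | cell J => exact ⟨J, rfl⟩
        | outside => exact absurd hi (hW _ hxW i)
      choose w hw using hcell
      have : itinerary T (cellLabel 𝒜) m x = fun i => CellLabel.cell (w i) := funext hw
      exact ⟨w, this ▸ hxW, hw⟩

/-- A separated set is, up to the cylinders that meet the separating set, a union of cylinders. -/
theorem MemClassT.exists_cylinderAlgebra_approx (h : MemClassT T μ 𝒜) (m : ℕ) {E : Finset I}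
    {G : Set I} (hE : Separates E G) :
    ∃ (S : Finset (Fin m → CellLabel 𝒜)) (D : Set I), S.card ≤ E.card ∧
      MeasurableSet[cylinderAlgebra T 𝒜 m] D ∧
      μ.real (symmDiff G D) ≤ μ.real (itinerary T (cellLabel 𝒜) m ⁻¹' S) := by
  classical
  have := h.isProbabilityMeasure
  set W : Set (Fin m → CellLabel 𝒜) :=
    {w | (∀ i, w i ≠ .outside) ∧ itinerary T (cellLabel 𝒜) m ⁻¹' {w} ⊆ G} with hWdef
  obtain ⟨D, hD, hDW⟩ := h.exists_cylinderAlgebra_ae_eq (W := W) fun w hw => hw.1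
  refine ⟨E.image (itinerary T (cellLabel 𝒜) m), D, Finset.card_image_le, hD, ?_⟩
  refine ENNReal.toReal_mono (measure_ne_top _ _) (measure_mono_ae ?_)
  filter_upwards [h.ae_iterate (ae_cellLabel_ne_none h.partition), hDW] with x hx hxD hxm
  have hxD' : x ∈ D ↔ itinerary T (cellLabel 𝒜) m x ∈ W := by
    change D x = _ at hxD
    exact iff_of_eq hxD
  have hxm' : x ∈ symmDiff G D := hxm
  change itinerary T (cellLabel 𝒜) m x ∈ ((E.image (itinerary T (cellLabel 𝒜) m) :
    Finset (Fin m → CellLabel 𝒜)) : Set (Fin m → CellLabel 𝒜))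
  by_contra hS
  have hnot : ∀ i, itinerary T (cellLabel 𝒜) m x i ≠ .outside := fun i => hx i
  -- Off the cylinders through points of `E`, of which there are at most `E.card`, the cylinder of
  -- `x` is an interval avoiding `E`, so it lies inside or outside `G`.
  have hmiss : ∀ e ∈ E, e ∉ itinerary T (cellLabel 𝒜) m ⁻¹' {itinerary T (cellLabel 𝒜) m x} :=
    fun e he hex => hS (Finset.mem_coe.2 (Finset.mem_image.2 ⟨e, he, hex⟩))
  rcases hE _ (h.ordConnected_cylinder _ hnot) hmiss with h1 | h1
  · have hxG : x ∈ G := h1 rfl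
    have hxW : itinerary T (cellLabel 𝒜) m x ∈ W := ⟨hnot, h1⟩
    rw [mem_symmDiff, hxD'] at hxm'
    tauto
  · have hxG : x ∉ G := fun hG => disjoint_left.1 h1 rfl hG
    have hxW : itinerary T (cellLabel 𝒜) m x ∉ W := fun hw => hxG (hw.2 rfl)
    rw [mem_symmDiff, hxD'] at hxm'
    tauto

theorem abs_measureReal_inter_sub_mul_le {X : Type*} [MeasurableSpace X] {μ : Measure X} [IsProbabilityMeasure μ]
    {G D B : Set X} (hG : MeasurableSet G) (hD : MeasurableSet D) (hB : MeasurableSet B) {p : ℝ}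
    (hp0 : 0 ≤ p) (hp1 : p ≤ 1) :
    |μ.real (G ∩ B) - μ.real G * p| ≤
      |μ.real (D ∩ B) - μ.real D * p| + 2 * μ.real (symmDiff G D) := by
  have h1 := abs_measureReal_sub_le_measureReal_symmDiff (μ := μ)
    hG.nullMeasurableSet hD.nullMeasurableSet
  have h2 := abs_measureReal_sub_le_measureReal_symmDiff (μ := μ)
    (hG.inter hB).nullMeasurableSet (hD.inter hB).nullMeasurableSet
  have h3 : μ.real (symmDiff (G ∩ B) (D ∩ B)) ≤ μ.real (symmDiff G D) := by
    refine measureReal_mono fun x hx => ?_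
    simp only [mem_symmDiff, mem_inter_iff] at hx ⊢
    tauto
  have e : μ.real (G ∩ B) - μ.real G * p = (μ.real (D ∩ B) - μ.real D * p)
      + (μ.real (G ∩ B) - μ.real (D ∩ B)) + (-((μ.real G - μ.real D) * p)) := by ring
  rw [e]
  refine (abs_add_three _ _ _).trans ?_
  rw [abs_neg, abs_mul, abs_of_nonneg hp0]
  have h4 : |μ.real G - μ.real D| * p ≤ |μ.real G - μ.real D| :=
    mul_le_of_le_one_right (abs_nonneg _) hp1
  linarith

/-- With `n = j + m` and `j` fixed, the `C exp (n a)` boundary points spoil at most `exp (m b)`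
cylinders of rank `m`, because `a < b`. What remains is a union of cylinders, to which α-mixing with
gap `j` applies. -/
theorem MemClassT.tendsto_of_isAlphaMixing (h : MemClassT T μ 𝒜) (hα : IsAlphaMixing T μ 𝒜)
    {a b : ℝ} (hab : a < b) (hb : 0 ≤ b) (hlt : ENNReal.ofReal b < ksEntropy μ T) {G : ℕ → Set I}
    (hGm : ∀ n, MeasurableSet (G n)) (hG : LowComplexity a G) {A : Set I} (hA : MeasurableSet A) :
    Tendsto (fun n => μ.real (G n ∩ T^[n] ⁻¹' A) - μ.real (G n) * μ.real A) atTop (𝓝 0) := by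
  have := h.isProbabilityMeasure
  have := h.countable
  have hT := h.ergodic.measurable
  have hl := measurable_cellLabel h.partition
  obtain ⟨α, hα0, hαlim, hαm⟩ := hα
  have hle : ∀ m, cylinderAlgebra T 𝒜 m ≤ (inferInstance : MeasurableSpace I) := by
    refine fun m => iSup_le fun j => ?_
    rw [MeasurableSpace.comap_generateFrom]
    refine MeasurableSpace.generateFrom_le ?_
    rintro _ ⟨J, hJ, rfl⟩
    exact (hT.iterate j) (h.partition.interval J hJ).measurableSet
  rw [Metric.tendsto_atTop']
  intro ε hε
  -- The gap is fixed before `n` grows. The errors are `ε / 4` from `α j`, and twice `ε / 8 + ε / 8`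
  -- from the two approximations of `G n`.
  obtain ⟨j, hj⟩ := (hαlim.eventually_lt_const (show 0 < ε / 4 by positivity)).exists
  obtain ⟨η, hη, hηA⟩ := h.exists_measureReal_le (show 0 < ε / 8 by positivity)
  obtain ⟨C, hC⟩ := hG η hη
  have hcov := eventually_measureReal_preimage_finset_le_of_generating h.ergodic hl
    (fun A hA => h.cylinderApprox hA) hb hlt (show 0 < ε / 8 by positivity)
  have hexp : Tendsto (fun m : ℕ => Real.exp (m * (b - a))) atTop atTop :=
    Real.tendsto_exp_atTop.comp
      (tendsto_natCast_atTop_atTop.atTop_mul_const (sub_pos.2 hab))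
  have hev : ∀ᶠ m : ℕ in atTop, |μ.real (G (j + m) ∩ T^[j + m] ⁻¹' A)
      - μ.real (G (j + m)) * μ.real A| < ε := by
    have hCj : ∀ᶠ m : ℕ in atTop, _ :=
      (tendsto_add_atTop_nat j).eventually hC
    filter_upwards [hcov, hCj, hexp.eventually_ge_atTop (C * Real.exp (j * a)),
      eventually_ge_atTop 1] with m hm1 hm2 hm3 hm4
    rw [add_comm m j] at hm2
    obtain ⟨E, G', hG', hE, hGG', hsep⟩ := hm2
    obtain ⟨S, D, hSE, hD, hGD⟩ := h.exists_cylinderAlgebra_approx m hsep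
    have hDm : MeasurableSet D := hle m D hD
    have hScard : (S.card : ℝ) ≤ Real.exp (m * b) := by
      calc (S.card : ℝ) ≤ E.card := by exact_mod_cast hSE
        _ ≤ C * Real.exp ((j + m : ℕ) * a) := hE
        _ = C * Real.exp (j * a) * Real.exp (m * a) := by
            rw [mul_assoc, ← Real.exp_add]
            push_cast
            ring_nf
        _ ≤ Real.exp (m * (b - a)) * Real.exp (m * a) := by gcongr
        _ = Real.exp (m * b) := by
            rw [← Real.exp_add]
            ring_nf
    have h1 := hm1 S hScard
    have h2 := hηA _ ((hGm (j + m)).symmDiff hG') hGG'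
    have h3 : μ.real (symmDiff (G (j + m)) D) ≤ ε / 4 := by
      have := measureReal_symmDiff_le (μ := μ) (s := G (j + m)) (t := G') D
      linarith
    have h4 := hαm m hm4 j D A hD hA
    have h5 := abs_measureReal_inter_sub_mul_le (μ := μ) (hGm (j + m)) hDm ((hT.iterate (j + m)) hA)
      (measureReal_nonneg (μ := μ) (s := A)) measureReal_le_one
    linarith
  obtain ⟨n0, hn0⟩ := eventually_atTop.1 hev
  refine ⟨j + n0, fun n hn => ?_⟩
  obtain ⟨m, rfl⟩ : ∃ m, n = j + m := ⟨n - j, by omega⟩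
  rw [Real.dist_0_eq_abs]
  exact hn0 m (by omega)

end AlphaMixing

/-! ### Null sequences in the mean -/

section WindowAverage

variable {κ : Type*} {l : Filter κ} {w : κ → Finset ℕ} {u v : ℕ → ℝ}

/-- The mean of `|u|` over the window `w p`. -/
def windowAverage (w : κ → Finset ℕ) (u : ℕ → ℝ) (p : κ) : ℝ :=
  ((w p).card : ℝ)⁻¹ * ∑ n ∈ w p, |u n|

theorem windowAverage_nonneg (w : κ → Finset ℕ) (u : ℕ → ℝ) (p : κ) : 0 ≤ windowAverage w u p := by
  unfold windowAverage
  positivity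

theorem windowAverage_add_le (w : κ → Finset ℕ) (u v : ℕ → ℝ) (p : κ) :
    windowAverage w (fun n => u n + v n) p ≤ windowAverage w u p + windowAverage w v p := by
  unfold windowAverage
  rw [← mul_add, ← Finset.sum_add_distrib]
  gcongr
  exact abs_add_le _ _

theorem windowAverage_le_of_forall_le {c : ℝ} (hc : 0 ≤ c) (h : ∀ n, |u n| ≤ c) (p : κ) :
    windowAverage w u p ≤ c := by
  unfold windowAverage
  calc _ ≤ ((w p).card : ℝ)⁻¹ * ∑ n ∈ w p, c := by gcongr; exact h _
    _ = ((w p).card : ℝ)⁻¹ * (w p).card * c := by rw [Finset.sum_const, nsmul_eq_mul]; ring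
    _ ≤ 1 * c := by gcongr; exact inv_mul_le_one
    _ = c := one_mul c

/-- The means of `|u|` over the windows `w` tend to `0`. -/
def MeanNull (l : Filter κ) (w : κ → Finset ℕ) (u : ℕ → ℝ) : Prop :=
  Tendsto (windowAverage w u) l (𝓝 0)

theorem MeanNull.add (hu : MeanNull l w u) (hv : MeanNull l w v) :
    MeanNull l w fun n => u n + v n := by
  have := Tendsto.add hu hv
  rw [add_zero] at this
  exact squeeze_zero (windowAverage_nonneg w _) (windowAverage_add_le w u v) this

theorem MeanNull.const_mul (hu : MeanNull l w u) (c : ℝ) : MeanNull l w fun n => c * u n := by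
  have := Tendsto.const_mul |c| hu
  rw [mul_zero] at this
  refine this.congr fun p => ?_
  simp only [windowAverage, abs_mul, ← Finset.mul_sum]
  ring

theorem meanNull_of_approx (h : ∀ ε > 0, ∃ v, MeanNull l w v ∧ ∀ n, |u n - v n| ≤ ε) :
    MeanNull l w u := by
  rw [MeanNull, Metric.tendsto_nhds]
  intro ε hε
  obtain ⟨v, hv, huv⟩ := h (ε / 2) (half_pos hε)
  filter_upwards [hv.eventually_lt_const (half_pos hε)] with p hp
  rw [Real.dist_0_eq_abs, abs_of_nonneg (windowAverage_nonneg w u p)]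
  have h1 := windowAverage_add_le w v (fun n => u n - v n) p
  simp only [add_sub_cancel] at h1
  have h2 := windowAverage_le_of_forall_le (w := w) (u := fun n => u n - v n) (half_pos hε).le huv p
  linarith

theorem meanNull_singleton : MeanNull atTop (fun n => {n}) u ↔ Tendsto u atTop (𝓝 0) := by
  rw [tendsto_zero_iff_norm_tendsto_zero]
  have h : windowAverage (fun n => {n}) u = fun n => ‖u n‖ := by
    funext n
    simp [windowAverage]
  rw [MeanNull, h]

theorem tendsto_sub_gapAtTop : Tendsto (fun p : ℕ × ℕ => p.2 - p.1) gapAtTop atTop := by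
  have h : Tendsto (fun p : ℕ × ℕ => (p.2 : ℤ) - (p.1 : ℤ)) gapAtTop atTop := tendsto_comap
  refine tendsto_atTop.2 fun b => ?_
  filter_upwards [h.eventually_ge_atTop (b : ℤ)] with p hp
  omega

theorem eventually_lt_gapAtTop : ∀ᶠ p : ℕ × ℕ in gapAtTop, p.1 < p.2 := by
  filter_upwards [tendsto_sub_gapAtTop.eventually_ge_atTop 1] with p hp
  omega

/-- The finitely many large terms contribute at most `K / (N - M)`, wherever the window stands. -/
theorem meanNull_Ico_of_tendsto (hu : Tendsto u atTop (𝓝 0)) :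
    MeanNull gapAtTop (fun p => Finset.Ico p.1 p.2) u := by
  refine meanNull_of_approx fun ε hε => ?_
  obtain ⟨n₀, hn₀⟩ := Metric.tendsto_atTop.1 hu ε hε
  refine ⟨fun n => if n < n₀ then u n else 0, ?_, fun n => ?_⟩
  · set K := ∑ n ∈ Finset.range n₀, |u n| with hK
    have hlim : Tendsto (fun p : ℕ × ℕ => ((p.2 - p.1 : ℕ) : ℝ)⁻¹ * K) gapAtTop (𝓝 (0 * K)) :=
      ((tendsto_inv_atTop_zero.comp tendsto_natCast_atTop_atTop).comp
        tendsto_sub_gapAtTop).mul_const K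
    rw [zero_mul] at hlim
    refine squeeze_zero (windowAverage_nonneg _ _) (fun p => ?_) hlim
    unfold windowAverage
    rw [Nat.card_Ico]
    gcongr
    calc ∑ n ∈ Finset.Ico p.1 p.2, |if n < n₀ then u n else 0|
        = ∑ n ∈ (Finset.Ico p.1 p.2).filter (· < n₀), |u n| := by
          rw [Finset.sum_filter]
          exact Finset.sum_congr rfl fun n _ => by split_ifs <;> simp
      _ ≤ K := Finset.sum_le_sum_of_subset_of_nonneg
          (fun n hn => Finset.mem_range.2 (Finset.mem_filter.1 hn).2) fun _ _ _ => abs_nonneg _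
  · by_cases h : n < n₀
    · simp [h, hε.le]
    · have := hn₀ n (not_lt.1 h)
      rw [Real.dist_0_eq_abs] at this
      simpa [h] using this.le

end WindowAverage

/-! ### From the invariant measures to an absolutely continuous one. -/

section ChangeOfMeasure

variable {X : Type*} [MeasurableSpace X] {μ ν : Measure X} {κ : Type*} {l : Filter κ}
  {w : κ → Finset ℕ} {g : ℕ → X → ℝ}

/-- The admissible `f` include multiples of indicators and are stable under sums and, because `|g n|
≤ 1`, under `L¹` limits. -/
theorem meanNull_integral_mul [IsFiniteMeasure μ] (hg : ∀ n, Measurable (g n))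
    (hb : ∀ n x, |g n x| ≤ 1) (h : ∀ B, MeasurableSet B → MeanNull l w fun n => ∫ x in B, g n x ∂μ)
    {f : X → ℝ} (hf : Integrable f μ) : MeanNull l w fun n => ∫ x, f x * g n x ∂μ := by
  have hfg : ∀ {f : X → ℝ}, Integrable f μ → ∀ n, Integrable (fun x => f x * g n x) μ :=
    fun hf n => hf.mul_bdd (c := 1) (hg n).aestronglyMeasurable (Eventually.of_forall (hb n))
  have hclose : ∀ {f f' : X → ℝ}, Integrable f μ → Integrable f' μ → ∀ n,
      |∫ x, f x * g n x ∂μ - ∫ x, f' x * g n x ∂μ| ≤ ∫ x, |f x - f' x| ∂μ := by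
    intro f f' hf hf' n
    rw [← integral_sub (hfg hf n) (hfg hf' n)]
    refine abs_integral_le_integral_abs.trans (integral_mono ((hfg hf n).sub (hfg hf' n)).abs
      (hf.sub hf').abs fun x => ?_)
    simp only [← sub_mul, abs_mul]
    exact mul_le_of_le_one_right (abs_nonneg _) (hb n x)
  refine Integrable.induction (fun f => MeanNull l w fun n => ∫ x, f x * g n x ∂μ) ?_ ?_ ?_ ?_ hf
  · intro c s hs _
    refine ((h s hs).const_mul c).congr fun p => ?_
    congr 1
    funext n
    rw [← integral_const_mul, ← integral_indicator hs]
    refine integral_congr_ae (Eventually.of_forall fun x => ?_)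
    by_cases hx : x ∈ s <;> simp [hx]
  · intro f f' _ hf hf' h1 h2
    refine (h1.add h2).congr fun p => ?_
    congr 1
    funext n
    rw [← integral_add (hfg hf n) (hfg hf' n)]
    simp [add_mul]
  · rw [← isSeqClosed_iff_isClosed]
    intro F f hF hlim
    refine meanNull_of_approx fun ε hε => ?_
    obtain ⟨n, hn⟩ := (Metric.tendsto_atTop.1 hlim ε hε)
    refine ⟨_, hF n, fun k => ?_⟩
    refine (hclose (L1.integrable_coeFn f) (L1.integrable_coeFn (F n)) k).trans ?_
    have := (hn n le_rfl).le
    rwa [dist_comm, L1.dist_eq_integral_dist] at this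
  · intro f f' hff' hf h1
    refine h1.congr fun p => ?_
    congr 1
    funext n
    refine integral_congr_ae ?_
    filter_upwards [hff'] with x hx
    rw [hx]

theorem meanNull_setIntegral_of_absolutelyContinuous [IsFiniteMeasure μ] [IsFiniteMeasure ν]
    (hνμ : ν ≪ μ) (hg : ∀ n, Measurable (g n)) (hb : ∀ n x, |g n x| ≤ 1)
    (h : ∀ B, MeasurableSet B → MeanNull l w fun n => ∫ x in B, g n x ∂μ) {B : Set X}
    (hB : MeasurableSet B) : MeanNull l w fun n => ∫ x in B, g n x ∂ν := by
  have hi : Integrable (fun x => (ν.rnDeriv μ x).toReal) μ := Measure.integrable_toReal_rnDeriv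
  refine (meanNull_integral_mul hg hb h (hi.indicator hB)).congr fun p => ?_
  congr 1
  funext n
  rw [← integral_indicator hB, ← integral_rnDeriv_smul hνμ]
  refine integral_congr_ae (Eventually.of_forall fun x => ?_)
  by_cases hx : x ∈ B <;> simp [hx]

theorem setIntegral_indicator_mul_sub [IsFiniteMeasure μ] {B G S : Set X}
    (hG : MeasurableSet G) (hS : MeasurableSet S) (p : ℝ) :
    ∫ x in B, G.indicator (fun x => S.indicator (fun _ => (1 : ℝ)) x - p) x ∂μ
      = μ.real (B ∩ G ∩ S) - μ.real (B ∩ G) * p := by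
  rw [setIntegral_indicator hG, integral_sub ((integrable_const _).indicator hS)
    (integrable_const _), integral_indicator hS]
  simp [Measure.restrict_restrict hS, inter_comm S]

/-- Asymptotic independence of `G n` and `S n` passes to absolutely continuous measures. -/
theorem meanNull_of_absolutelyContinuous [IsFiniteMeasure μ] [IsFiniteMeasure ν]
    (hνμ : ν ≪ μ) {G S : ℕ → Set X} (hG : ∀ n, MeasurableSet (G n)) (hS : ∀ n, MeasurableSet (S n))
    {p : ℝ} (hp0 : 0 ≤ p) (hp1 : p ≤ 1)
    (h : ∀ B, MeasurableSet B →
      MeanNull l w fun n => μ.real (B ∩ G n ∩ S n) - μ.real (B ∩ G n) * p) {B : Set X}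
    (hB : MeasurableSet B) :
    MeanNull l w fun n => ν.real (B ∩ G n ∩ S n) - ν.real (B ∩ G n) * p := by
  -- The function `1_G (1_S - p)` encodes the defect of independence on all sets `B` at once, and `p
  -- ∈ [0, 1]` bounds it by one.
  have := meanNull_setIntegral_of_absolutelyContinuous (l := l) (w := w)
    (g := fun n => (G n).indicator fun x => (S n).indicator (fun _ => (1 : ℝ)) x - p) hνμ
    (fun n => ((measurable_const.indicator (hS n)).sub_const p).indicator (hG n))
    (fun n x => ?_) (fun B' hB' => ?_) hB
  · simpa only [setIntegral_indicator_mul_sub (hG _) (hS _)] using this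
  · by_cases h1 : x ∈ G n <;> by_cases h2 : x ∈ S n <;> simp [h1, h2, abs_le] <;>
      exact ⟨by linarith, by linarith⟩
  · simpa only [setIntegral_indicator_mul_sub (hG _) (hS _)] using h B' hB'

end ChangeOfMeasure

/-! ### Weak mixing -/

section WeakMixing

theorem sq_average_abs_le_average_sq {s : Finset ℕ} (u : ℕ → ℝ) :
    ((s.card : ℝ)⁻¹ * ∑ n ∈ s, |u n|) ^ 2 ≤ (s.card : ℝ)⁻¹ * ∑ n ∈ s, u n ^ 2 := by
  rcases s.eq_empty_or_nonempty with rfl | hs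
  · simp
  have hc : (0 : ℝ) < s.card := by exact_mod_cast hs.card_pos
  have h := sq_sum_le_card_mul_sum_sq (s := s) (f := fun n => |u n|)
  simp only [sq_abs] at h
  rw [mul_pow, sq (s.card : ℝ)⁻¹, mul_assoc]
  refine mul_le_mul_of_nonneg_left ?_ (by positivity)
  rwa [inv_mul_le_iff₀ hc]

variable {X : Type*} [MeasurableSpace X] {μ : Measure X} {T : X → X}

theorem IsMixing.meanNull (h : IsMixing μ T) {A B : Set X} (hA : MeasurableSet A)
    (hB : MeasurableSet B) :
    MeanNull atTop (fun n => {n}) fun n => μ.real (A ∩ T^[n] ⁻¹' B) - μ.real A * μ.real B := by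
  rw [meanNull_singleton]
  exact tendsto_sub_nhds_zero_iff.2 (h.2 A B hA hB)

variable [IsProbabilityMeasure μ]

/-- A weakly mixing map mixes along almost all times, uniformly in the position of the window. -/
theorem IsWeaklyMixing.meanNull (h : IsWeaklyMixing μ T) {A B : Set X} (hA : MeasurableSet A)
    (hB : MeasurableSet B) :
    MeanNull gapAtTop (fun p => Finset.Ico p.1 p.2)
      fun n => μ.real (A ∩ T^[n] ⁻¹' B) - μ.real A * μ.real B := by
  obtain ⟨hT, hS⟩ := h
  set S := Prod.map T T with hSdef
  have hSmp := hS.toMeasurePreserving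
  let g : X → ℝ := fun x => B.indicator (fun _ => 1) x - μ.real B
  have hg : Measurable g := (measurable_const.indicator hB).sub_const _
  have hgb : ∀ x, ‖g x‖ ≤ 1 := by
    intro x
    have h0 := measureReal_nonneg (μ := μ) (s := B)
    have h1 := measureReal_le_one (μ := μ) (s := B)
    rw [Real.norm_eq_abs]
    by_cases hx : x ∈ B <;> simp [g, hx, abs_le] <;> linarith
  have hgi : Integrable g μ :=
    Integrable.of_bound hg.aestronglyMeasurable 1 (Eventually.of_forall hgb)
  have hg0 : ∫ x, g x ∂μ = 0 := by
    simp only [g]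
    rw [integral_sub ((integrable_const _).indicator hB) (integrable_const _),
      integral_indicator hB]
    simp
  -- The square of a correlation on `A` is an integral over `A ×ˢ A` in the product system, where
  -- ergodicity of `T × T` controls averages. Cauchy–Schwarz returns from squares to absolute
  -- values.
  let G : X × X → ℝ := fun z => g z.1 * g z.2
  have hGi : Integrable G (μ.prod μ) := hgi.mul_prod hgi
  have hG0 : ∫ z, G z ∂(μ.prod μ) = 0 := by
    simp only [G]
    rw [integral_prod_mul, hg0, zero_mul]
  have herg := tendsto_integral_abs_birkhoffAverage_sub hS hGi
  simp only [hG0, sub_zero] at herg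
  set e : ℕ → ℝ := fun n => ∫ z, |birkhoffAverage ℝ S G n z| ∂(μ.prod μ)
  have hu : ∀ n, μ.real (A ∩ T^[n] ⁻¹' B) - μ.real A * μ.real B
      = ∫ x, A.indicator (fun x => g (T^[n] x)) x ∂μ := by
    intro n
    have hTB := (hT.measurable.iterate n) hB
    have := setIntegral_indicator_mul_sub (μ := μ) (B := univ) hA hTB (μ.real B)
    rw [univ_inter] at this
    rw [← this, setIntegral_univ]
    rfl
  have hu2 : ∀ n, (μ.real (A ∩ T^[n] ⁻¹' B) - μ.real A * μ.real B) ^ 2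
      = ∫ z, (A ×ˢ A).indicator (fun z => G (S^[n] z)) z ∂(μ.prod μ) := by
    intro n
    rw [hu, sq, ← integral_prod_mul]
    refine integral_congr_ae (Eventually.of_forall fun z => ?_)
    simp only [hSdef, Prod.map_iterate]
    by_cases h1 : z.1 ∈ A <;> by_cases h2 : z.2 ∈ A <;> simp [indicator, h1, h2, G]
  have hGn : ∀ n, Integrable (fun z => (A ×ˢ A).indicator (fun z => G (S^[n] z)) z) (μ.prod μ) :=
    fun n => ((hSmp.iterate n).integrable_comp_of_integrable hGi).indicator (hA.prod hA)
  have hlim : Tendsto (fun p : ℕ × ℕ => Real.sqrt (e (p.2 - p.1))) gapAtTop (𝓝 0) := by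
    have := (Real.continuous_sqrt.tendsto 0).comp (herg.comp tendsto_sub_gapAtTop)
    rwa [Real.sqrt_zero] at this
  refine squeeze_zero (windowAverage_nonneg _ _) (fun p => Real.le_sqrt_of_sq_le ?_) hlim
  refine (sq_average_abs_le_average_sq _).trans ?_
  rw [Nat.card_Ico]
  simp only [hu2]
  rw [← integral_finsetSum _ fun n _ => hGn n, ← integral_const_mul]
  have hbi : Integrable (fun z => |birkhoffAverage ℝ S G (p.2 - p.1) (S^[p.1] z)|) (μ.prod μ) :=
    (hSmp.iterate p.1).integrable_comp_of_integrable
      (integrable_birkhoffAverage hSmp hGi (p.2 - p.1)).abs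
  -- By invariance of the product measure the starting time drops out and only the window length
  -- matters.
  have he : e (p.2 - p.1)
      = ∫ z, |birkhoffAverage ℝ S G (p.2 - p.1) (S^[p.1] z)| ∂(μ.prod μ) :=
    (integral_comp_iterate hSmp (integrable_birkhoffAverage hSmp hGi (p.2 - p.1)).abs p.1).symm
  rw [he]
  refine integral_mono ((integrable_finsetSum _ fun n _ => hGn n).const_mul _) hbi fun z => ?_
  by_cases hz : z ∈ A ×ˢ A
  · simp only [indicator_of_mem hz]
    refine le_trans (le_of_eq ?_) (le_abs_self _)
    simp only [birkhoffAverage, birkhoffSum, smul_eq_mul]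
    rw [Finset.sum_Ico_eq_sum_range]
    congr 1
    refine Finset.sum_congr rfl fun n _ => ?_
    rw [← Function.iterate_add_apply, add_comm]
  · simp only [indicator_of_notMem hz]
    simp

end WeakMixing

/-! ### Joint ergodicity -/

section JointMixing

/-- The maps of positive index are asymptotically independent of the map of index `0`. -/
theorem tendsto_measureReal_inter_sub (k : ℕ) : ∀ (T : Fin (k + 1) → I → I)
    (μ : Fin (k + 1) → Measure I) (𝒜 : Fin (k + 1) → Set (Set I)),
    (∀ i, MemClassT (T i) (μ i) (𝒜 i)) →
    (∀ i, i ≠ 0 → IsAlphaMixing (T i) (μ i) (𝒜 i)) →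
    (StrictMono fun i => ksEntropy (μ i) (T i)) →
    ∀ (ν : Measure I) [IsProbabilityMeasure ν], ν ≪ volume →
    ∀ (B : Set I) (A : Fin (k + 1) → Set I), MeasurableSet B → (∀ i, MeasurableSet (A i)) →
    Tendsto (fun n : ℕ => ν.real (B ∩ ⋂ i, (T i)^[n] ⁻¹' A i) -
      ν.real (B ∩ (T 0)^[n] ⁻¹' A 0) * ∏ i : Fin k, (μ i.succ).real (A i.succ)) atTop (𝓝 0) := by
  induction k with
  | zero =>
    intro T μ 𝒜 hT hα hmono ν _ hν B A hB hA
    have : ∀ n : ℕ, ⋂ i, (T i)^[n] ⁻¹' A i = (T 0)^[n] ⁻¹' A 0 := fun n => by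
      ext x
      simp [Fin.forall_fin_one]
    simp [this]
  | succ k ih =>
    intro T μ 𝒜 hT hα hmono ν _ hν B A hB hA
    -- The map of largest entropy is split off; the induction hypothesis covers the others, index
    -- `0` among them.
    set z := Fin.last (k + 1)
    have := (hT z).isProbabilityMeasure
    have hih := ih (fun i => T i.castSucc) (fun i => μ i.castSucc) (fun i => 𝒜 i.castSucc)
      (fun i => hT _) (fun i hi => hα _ (by simpa using hi))
      (fun i j hij => hmono (Fin.castSucc_lt_castSucc_iff.2 hij)) ν hν B (fun i => A i.castSucc) hB
      (fun i => hA _)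
    set G : ℕ → Set I := fun n => ⋂ i : Fin (k + 1), (T i.castSucc)^[n] ⁻¹' A i.castSucc
    have hGm : ∀ n, MeasurableSet (G n) := fun n =>
      MeasurableSet.iInter fun i => ((hT _).ergodic.measurable.iterate n) (hA _)
    have hlt : ksEntropy (μ (Fin.last k).castSucc) (T (Fin.last k).castSucc)
        < ksEntropy (μ z) (T z) := hmono (Fin.castSucc_lt_last _)
    -- Both numbers lie between the two largest entropies: `a` bounds the complexity of `G`, and `b`
    -- the number of negligible cylinders of the last map.
    obtain ⟨a, ha0, ha1, ha2⟩ := ENNReal.lt_iff_exists_real_btwn.1 hlt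
    obtain ⟨b, hb0, hb1, hb2⟩ := ENNReal.lt_iff_exists_real_btwn.1 ha2
    have hab : a < b := (ENNReal.ofReal_lt_ofReal_iff_of_nonneg ha0).1 hb1
    have hGc : LowComplexity a G := lowComplexity_iInter fun i =>
      (hT i.castSucc).lowComplexity_preimage (lt_of_le_of_lt
        (hmono.monotone (Fin.castSucc_le_castSucc_iff.2 (Fin.le_last i))) ha1) (hA _)
    have hstep : Tendsto (fun n => ν.real (B ∩ G n ∩ (T z)^[n] ⁻¹' A z)
        - ν.real (B ∩ G n) * (μ z).real (A z)) atTop (𝓝 0) := by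
      -- Passing from `μ z` to `ν` requires independence on every `B'`, so `G n` is intersected with
      -- a fixed set, which has low complexity as well.
      rw [← meanNull_singleton]
      refine meanNull_of_absolutelyContinuous (hν.trans (hT z).absolutelyContinuous') hGm
        (fun n => ((hT z).ergodic.measurable.iterate n) (hA z)) measureReal_nonneg
        measureReal_le_one (fun B' hB' => ?_) hB
      rw [meanNull_singleton]
      exact (hT z).tendsto_of_isAlphaMixing (hα z (Fin.last_pos).ne') hab hb0 hb2
        (fun n => hB'.inter (hGm n)) (((hT z).lowComplexity_const ha0 hB').inter hGc) (hA z)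
    have hsum := hstep.add (hih.mul_const ((μ z).real (A z)))
    rw [zero_mul, add_zero] at hsum
    refine hsum.congr fun n => ?_
    have e1 : B ∩ ⋂ i, (T i)^[n] ⁻¹' A i = B ∩ G n ∩ (T z)^[n] ⁻¹' A z := by
      ext x
      simp only [G, z, mem_inter_iff, mem_iInter, Fin.forall_fin_succ', and_assoc]
    rw [e1, Fin.prod_univ_castSucc]
    simp only [Fin.succ_castSucc, Fin.succ_last, Fin.castSucc_zero, z, G]
    ring

/-- Common source of both conclusions: `hw` says that the windows respect null sequences, and `hmix`
supplies the mixing of `T 0` in the corresponding mode. -/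
theorem meanNull_measureReal_inter {κ : Type*} {l : Filter κ} {w : κ → Finset ℕ}
    (hw : ∀ u : ℕ → ℝ, Tendsto u atTop (𝓝 0) → MeanNull l w u) {k : ℕ}
    {T : Fin (k + 1) → I → I} {μ : Fin (k + 1) → Measure I} {𝒜 : Fin (k + 1) → Set (Set I)}
    (hT : ∀ i, MemClassT (T i) (μ i) (𝒜 i))
    (hα : ∀ i, i ≠ 0 → IsAlphaMixing (T i) (μ i) (𝒜 i))
    (hmono : StrictMono fun i => ksEntropy (μ i) (T i))
    {ν : Measure I} [IsProbabilityMeasure ν] (hν : ν ≪ volume)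
    {B : Set I} {A : Fin (k + 1) → Set I} (hB : MeasurableSet B) (hA : ∀ i, MeasurableSet (A i))
    (hmix : ∀ B', MeasurableSet B' → MeanNull l w fun n =>
      (μ 0).real (B' ∩ (T 0)^[n] ⁻¹' A 0) - (μ 0).real B' * (μ 0).real (A 0)) :
    MeanNull l w fun n =>
      ν.real (B ∩ ⋂ i, (T i)^[n] ⁻¹' A i) - ν.real B * ∏ i, (μ i).real (A i) := by
  have := (hT 0).isProbabilityMeasure
  have h1 := hw _ (tendsto_measureReal_inter_sub k T μ 𝒜 hT hα hmono ν hν B A hB hA)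
  have h2 := meanNull_of_absolutelyContinuous (l := l) (w := w)
    (hν.trans (hT 0).absolutelyContinuous')
    (G := fun _ => univ) (S := fun n => (T 0)^[n] ⁻¹' A 0) (fun _ => MeasurableSet.univ)
    (fun n => ((hT 0).ergodic.measurable.iterate n) (hA 0)) measureReal_nonneg measureReal_le_one
    (by simpa only [inter_univ] using hmix) hB
  simp only [inter_univ] at h2
  have h3 := h1.add (h2.const_mul (∏ i : Fin k, (μ i.succ).real (A i.succ)))
  refine h3.congr fun p => ?_
  congr 1
  funext n
  rw [Fin.prod_univ_succ]
  ring

end JointMixing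

end JointErgodicity

end

theorem theorem1p12 (k : ℕ)
    (T : Fin (k + 1) → unitInterval → unitInterval)
    (μ : Fin (k + 1) → MeasureTheory.Measure unitInterval)
    (𝒜 : Fin (k + 1) → Set (Set unitInterval))
    (hT : ∀ i, JointErgodicity.MemClassT (T i) (μ i) (𝒜 i))
    (hα : ∀ i, i ≠ 0 → JointErgodicity.IsAlphaMixing (T i) (μ i) (𝒜 i))
    (hmono : StrictMono fun i => JointErgodicity.ksEntropy (μ i) (T i))
    (hfin : ∀ i, JointErgodicity.ksEntropy (μ i) (T i) < ⊤)
    (ν : MeasureTheory.Measure unitInterval) [MeasureTheory.IsProbabilityMeasure ν]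
    (hν : ν ≪ MeasureTheory.volume) (hν' : MeasureTheory.volume ≪ ν) :
    (JointErgodicity.IsMixing (μ 0) (T 0) →
      ∀ (B : Set unitInterval) (A : Fin (k + 1) → Set unitInterval),
        MeasurableSet B → (∀ i, MeasurableSet (A i)) →
        Tendsto (fun n : ℕ => ν.real (B ∩ ⋂ i, (T i)^[n] ⁻¹' A i)) atTop
          (𝓝 (ν.real B * ∏ i, (μ i).real (A i)))) ∧
    (JointErgodicity.IsWeaklyMixing (μ 0) (T 0) →
      ∀ (B : Set unitInterval) (A : Fin (k + 1) → Set unitInterval),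
        MeasurableSet B → (∀ i, MeasurableSet (A i)) →
        Tendsto
          (fun p : ℕ × ℕ => ((p.2 : ℝ) - (p.1 : ℝ))⁻¹ *
            ∑ n ∈ Finset.Ico p.1 p.2,
              |ν.real (B ∩ ⋂ i, (T i)^[n] ⁻¹' A i) - ν.real B * ∏ i, (μ i).real (A i)|)
          JointErgodicity.gapAtTop (𝓝 0)) := by
  have := (hT 0).isProbabilityMeasure
  refine ⟨fun hmix B A hB hA => ?_, fun hmix B A hB hA => ?_⟩
  · rw [← tendsto_sub_nhds_zero_iff, ← JointErgodicity.meanNull_singleton]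
    exact JointErgodicity.meanNull_measureReal_inter
      (fun u hu => JointErgodicity.meanNull_singleton.2 hu) hT hα hmono hν hB hA
      fun B' hB' => hmix.meanNull hB' (hA 0)
  · have h : JointErgodicity.MeanNull _ _ _ := JointErgodicity.meanNull_measureReal_inter
      (fun u hu => JointErgodicity.meanNull_Ico_of_tendsto hu) hT hα hmono hν hB hA
      fun B' hB' => hmix.meanNull hB' (hA 0)
    -- The window's cardinality is a truncated difference, equal to the real `N - M` once `M ≤ N`.
    refine Tendsto.congr' ?_ h
    filter_upwards [JointErgodicity.eventually_lt_gapAtTop] with p hp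
    rw [JointErgodicity.windowAverage, Nat.card_Ico, Nat.cast_sub hp.le]
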